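/- Let $X$ be a quasi-compact and semi-separated scheme (i.e. the diagonal of $X$ is affine). A \emph{vector bundle} on $X$ (in Drinfeld's sense) is a quasi-coherent $\mathcal{O}_X$-module $\mathcal{P}$ such that $\mathcal{P}(U)$ is a projective $\mathcal{O}_X(U)$-module for every affine open $U\subseteq X$; a quasi-coherent sheaf $\mathcal{F}$ is \emph{flat} (resp. \emph{locally countably generated}, \emph{of finite type}) if $\mathcal{F}(U)$ is a flat (resp. countably generated, finitely generated) $\mathcal{O}_X(U)$-module for every affine open $U\subseteq X$. We say that $X$ \emph{has enough locally countably generated vector bundles} if every quasi-coherent sheaf on $X$ is a quotient of a direct sum of locally countably generated vector bundles. (1) If $X$ has the resolution property, i.e. every quasi-coherent sheaf of finite type is a quotient of a vector bundle of finite type, then $X$ has enough locally countably generated vector bundles. (2) Suppose that $X$ has enough locally countably generated vector bundles. Then every flat quasi-coherent sheaf $\mathcal{F}$ on $X$ is a direct limit $\mathcal{F}=\varinjlim_{i\in I}\mathcal{F}_i$, over a nonempty directed partially ordered set $I$, of locally countably generated flat quasi-coherent sheaves $\mathcal{F}_i$, each of which satisfies $\mathcal{V}\mathrm{dim}\,\mathcal{F}_i\le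 1$, i.e. admits an exact sequence $0\to\mathcal{P}_1\to\mathcal{P}_0\to\mathcal{F}_i\to 0$ with $\mathcal{P}_0$ and $\mathcal{P}_1$ vector bundles. -/

import Mathlib

open CategoryTheory CategoryTheory.Limits AlgebraicGeometry

universe u

namespace QCohSheaf

variable {X : Scheme.{u}}

/-- A module is countably generated if it is spanned by a countable subset. -/
def IsCountablyGenerated (R : Type*) (M : Type*) [CommRing R] [AddCommGroup M] [Module R M] :
    Prop :=
  ∃ s : Set M, s.Countable ∧ Submodule.span R s = ⊤

/-- A vector bundle in the sense of Drinfeld: a quasi-coherent `𝒪_X`-module whose sections over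
every affine open `U` form a projective `Γ(X, U)`-module (of arbitrary, possibly infinite, rank). -/
structure IsVectorBundle (P : X.Modules) : Prop where
  isQuasicoherent : P.IsQuasicoherent
  projective : ∀ U : X.Opens, IsAffineOpen U → Module.Projective Γ(X, U) Γ(P, U)

/-- A flat quasi-coherent sheaf: the sections over every affine open `U` form a flat
`Γ(X, U)`-module. -/
structure IsFlatQuasicoherent (F : X.Modules) : Prop where
  isQuasicoherent : F.IsQuasicoherent
  flat : ∀ U : X.Opens, IsAffineOpen U → Module.Flat Γ(X, U) Γ(F, U)

/-- The sections over every affine open `U` form a countably generated `Γ(X, U)`-module. -/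
def IsLocallyCountablyGenerated (F : X.Modules) : Prop :=
  ∀ U : X.Opens, IsAffineOpen U → IsCountablyGenerated Γ(X, U) Γ(F, U)

/-- The sections over every affine open `U` form a finitely generated `Γ(X, U)`-module. -/
def IsLocallyFinitelyGenerated (F : X.Modules) : Prop :=
  ∀ U : X.Opens, IsAffineOpen U → Module.Finite Γ(X, U) Γ(F, U)

/-- The dimension of `F` with respect to the class of all vector bundles is at most one: there is
an exact sequence `0 ⟶ P₁ ⟶ P₀ ⟶ F ⟶ 0` with `P₀` and `P₁` vector bundles. -/
def VDimLEOne (F : X.Modules) : Prop :=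
  ∃ (P₁ P₀ : X.Modules) (f : P₁ ⟶ P₀) (g : P₀ ⟶ F) (w : f ≫ g = 0),
    IsVectorBundle P₁ ∧ IsVectorBundle P₀ ∧ (ShortComplex.mk f g w).ShortExact

variable (X)

/-- `X` has enough locally countably generated vector bundles: they generate the category of
quasi-coherent sheaves, i.e. every quasi-coherent sheaf is a quotient of a (small) direct sum of
locally countably generated vector bundles. -/
def HasEnoughLocallyCountablyGeneratedVectorBundles : Prop :=
  ∀ F : X.Modules, F.IsQuasicoherent →
    ∃ (J : Type u) (P : J → X.Modules) (π : ∐ P ⟶ F),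
      (∀ j, IsVectorBundle (P j) ∧ IsLocallyCountablyGenerated (P j)) ∧ Epi π

/-- `X` has the resolution property: every quasi-coherent sheaf of finite type is a quotient of a
vector bundle of finite type, i.e. of a locally free sheaf of finite rank. (On a noetherian scheme
the quasi-coherent sheaves of finite type are the coherent sheaves.) -/
def HasResolutionProperty : Prop :=
  ∀ F : X.Modules, F.IsQuasicoherent → IsLocallyFinitelyGenerated F →
    ∃ (P : X.Modules) (π : P ⟶ F),
      IsVectorBundle P ∧ IsLocallyFinitelyGenerated P ∧ Epi π

end QCohSheaf

/-!
*Sheaves as modules.* Everything is reduced to modules of sections over affine opens. A sheaf of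
modules is quasi-coherent iff restriction to each basic open of each affine open is a localization
(`isQuasicoherent_iff_localizesAt`). Sections over an affine open therefore turn coproducts and
cokernels of quasi-coherent sheaves into direct sums and cokernels of modules, kernels stay
quasi-coherent, and flatness, finiteness and surjectivity may be tested on an affine cover.

*Resolution property.* Since affine opens meet in affine opens, a family of sections of `G` over an
affine open `U` cuts out the quasi-coherent subsheaf of those sections whose restriction to `U` is
generated by the family (`exists_subsheaf`). Imposing this condition on the members of a finite
affine cover one after the other, every section of a quasi-coherent sheaf over an affine open lies
in the image of a quasi-coherent sheaf of finite type (`exists_finite_type_hom`). The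
resolution property replaces these sheaves by vector bundles of finite type, and their direct sum
over all sections on a finite affine cover is the required generator.

*Flat sheaves.* If there are enough locally countably generated vector bundles, `F` has a
presentation `∐ Q ⟶ ∐ P ⟶ F ⟶ 0` by such bundles. For countable sets of indices `S`, `T` such that
`∐_S Q` is mapped into `∐_T P`, let `D` be the cokernel of `∐_S Q ⟶ ∐_T P`. The sheaf `F` is the
directed colimit of these `D`, and it remains to see that the pairs `(S, T)` with flat `D` are
cofinal. By the equational criterion, flatness of `F` over one affine open means that every relation
factors through a finite free module; a countable family of such factorizations involves only
countably many further indices (`exists_countable_factorsThroughFree`). So any pair can be enlarged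
countably often, over all members of a finite affine cover simultaneously, and the union of the
resulting chain has flat cokernel (`flat_of_chain`, `exists_flat_isCountablePair`).

*Dimension.* A countably presented flat module is a colimit of a sequence of finite free modules,
so the telescope exhibits it as the quotient of a projective module by a projective submodule. By
Schanuel's lemma the kernel of any projective presentation is projective
(`projective_ker_of_flat_of_countable`), which makes the kernel of `∐_T P ⟶ D` a vector bundle.
-/

universe w' w

namespace QCohSheaf

variable {X : Scheme.{u}}

open Scheme.Modules

/-! ### Quasi-coherence and localization of sections -/

/-- Restriction `Γ(M, U) → Γ(M, V)` behaves as the localization at `f`, in terms of elements: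
every section over `V` extends to `U` after multiplication by a power of `f`, and a section over
`U` vanishing on `V` is killed by a power of `f`. That `f` acts invertibly on `Γ(M, V)` is not
part of the definition; it is automatic for `V = D(f)`. -/
def LocalizesAt (M : X.Modules) {V U : X.Opens} (h : V ≤ U) (f : Γ(X, U)) : Prop :=
  (∀ s : Γ(M, V), ∃ (n : ℕ) (t : Γ(M, U)),
    M.presheaf.map (homOfLE h).op t = (X.presheaf.map (homOfLE h).op f) ^ n • s) ∧
  ∀ t : Γ(M, U), M.presheaf.map (homOfLE h).op t = 0 → ∃ n : ℕ, f ^ n • t = 0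

lemma localizesAt_congr (M : X.Modules) {V U V' U' : X.Opens} (h : V ≤ U) (h' : V' ≤ U')
    (hU : U' = U) (hV : V' = V) (f : Γ(X, U)) :
    LocalizesAt M h' (X.presheaf.map (homOfLE hU.le).op f) ↔ LocalizesAt M h f := by
  subst hU hV
  simp

/-- Under the identification of `Γ(Spec Γ(X, U), W)` with the sections of `𝒪_X` over the image of
`W`, a scalar `r` acts through its restriction from `U`. -/
lemma fromSpec_appIso_inv {U : X.Opens} (hU : IsAffineOpen U) (W : (Spec Γ(X, U)).Opens)
    (hW : hU.fromSpec ''ᵁ W ≤ U) (r : Γ(X, U)) :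
    (hU.fromSpec.appIso W).inv ((Spec Γ(X, U)).presheaf.map W.leTop.op
      ((Scheme.ΓSpecIso Γ(X, U)).inv r)) = X.presheaf.map (homOfLE hW).op r := by
  have hW' : W ≤ hU.fromSpec ⁻¹ᵁ U := by rw [hU.fromSpec_preimage_self]; exact le_top
  have h1 := hU.fromSpec.appLE_appIso_inv hW'
  have h2 : hU.fromSpec.appLE U W hW' =
      (Scheme.ΓSpecIso Γ(X, U)).inv ≫ (Spec Γ(X, U)).presheaf.map W.leTop.op := by
    rw [Scheme.Hom.appLE, hU.fromSpec_app_self, Category.assoc, ← Functor.map_comp]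
    rfl
  rw [h2] at h1
  exact congr($(h1) r)

lemma smul_restrict_fromSpec {U : X.Opens} (hU : IsAffineOpen U) (M : X.Modules)
    (W : (Spec Γ(X, U)).Opens)
    (hW : hU.fromSpec ''ᵁ W ≤ U) (r : Γ(X, U)) (x : Γ(M.restrict hU.fromSpec, W)) :
    (M.restrictAppIso hU.fromSpec W).hom (r • x) =
      X.presheaf.map (homOfLE hW).op r • (M.restrictAppIso hU.fromSpec W).hom x := by
  rw [smul_Spec_def, ← fromSpec_appIso_inv]
  exact smul_restrictAppIso_hom_apply _ _ _ _ _

lemma fromSpec_image_le {U : X.Opens} (hU : IsAffineOpen U) (W : (Spec Γ(X, U)).Opens) :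
    hU.fromSpec ''ᵁ W ≤ U := by
  conv_rhs => rw [← hU.opensRange_fromSpec]
  exact Scheme.Hom.image_le_opensRange _ _

lemma fromSpec_image_top {U : X.Opens} (hU : IsAffineOpen U) :
    hU.fromSpec ''ᵁ ⊤ = U := by
  rw [Scheme.Hom.image_top_eq_opensRange, hU.opensRange_fromSpec]

/-- The distinguished open subset `D(f)`, as an open subset of the scheme `Spec R`. -/
def specBasicOpen {R : CommRingCat.{u}} (f : R) : (Spec R).Opens := PrimeSpectrum.basicOpen f

lemma isIso_fromTildeΓ_iff_localizes {R : CommRingCat.{u}} (N : (Spec R).Modules) :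
    IsIso (fromTildeΓ N) ↔ ∀ f : R,
      (∀ s : Γ(N, specBasicOpen f), ∃ (n : ℕ) (t : Γ(N, ⊤)),
        N.presheaf.map (specBasicOpen f).leTop.op t = f ^ n • s) ∧
      ∀ t : Γ(N, ⊤), N.presheaf.map (specBasicOpen f).leTop.op t = 0 →
        ∃ n : ℕ, f ^ n • t = 0 := by
  refine (isIso_fromTildeΓ_iff_isLocalizing N).trans (forall_congr' fun f => ⟨fun h => ?_,
    fun h => ?_⟩)
  · refine ⟨fun s => ?_, fun t ht => ?_⟩
    · obtain ⟨n, t, ht⟩ := @IsLocalizedModule.Away.surj _ _ _ _ _ _ _ _ _ f h s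
      exact ⟨n, t, ht.symm⟩
    · obtain ⟨n, hn⟩ := @IsLocalizedModule.Away.exists_of_eq _ _ _ _ _ _ _ _ _ f h t 0
        (ht.trans (map_zero _).symm)
      exact ⟨n, hn.trans (smul_zero _)⟩
  · refine IsLocalizedModule.Away.mk_of_addCommGroup ?_ ?_ ?_
    · exact isUnit_algebraMap_end_of_le_basicOpen f le_rfl
    · intro s
      obtain ⟨n, t, ht⟩ := h.1 s
      exact ⟨n, t, ht.symm⟩
    · intro t ht
      exact h.2 t ht

lemma isIso_fromTildeΓ_restrict_iff {U : X.Opens} (hU : IsAffineOpen U) (M : X.Modules) :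
    IsIso (fromTildeΓ (M.restrict hU.fromSpec)) ↔
      ∀ f : Γ(X, U), LocalizesAt M (X.basicOpen_le f) f := by
  refine (isIso_fromTildeΓ_iff_localizes _).trans (forall_congr' fun (f : Γ(X, U)) => ?_)
  have hD : hU.fromSpec ''ᵁ (specBasicOpen f) = X.basicOpen f := hU.fromSpec_image_basicOpen f
  have hDU : hU.fromSpec ''ᵁ (specBasicOpen f) ≤ hU.fromSpec ''ᵁ ⊤ :=
    Scheme.Hom.image_mono _ le_top
  rw [← localizesAt_congr M (X.basicOpen_le f) hDU (fromSpec_image_top hU) hD]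
  have hres : X.presheaf.map (homOfLE hDU).op
      (X.presheaf.map (homOfLE (fromSpec_image_top hU).le).op f) =
      X.presheaf.map (homOfLE (fromSpec_image_le hU _)).op f := by
    rw [← CommRingCat.comp_apply, ← Functor.map_comp]
    rfl
  unfold LocalizesAt
  simp only [hres]
  have hs1 : ∀ (n : ℕ) (s : Γ(M.restrict hU.fromSpec, specBasicOpen f)),
      (M.restrictAppIso hU.fromSpec _).hom (f ^ n • s) =
      (X.presheaf.map (homOfLE (fromSpec_image_le hU _)).op f) ^ n •
        (M.restrictAppIso hU.fromSpec _).hom s := fun n s => by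
    rw [smul_restrict_fromSpec hU M _ (fromSpec_image_le hU _), map_pow]
  have hs2 : ∀ (n : ℕ) (s : Γ(M.restrict hU.fromSpec, ⊤)),
      (M.restrictAppIso hU.fromSpec _).hom (f ^ n • s) =
      (X.presheaf.map (homOfLE (fromSpec_image_top hU).le).op f) ^ n •
        (M.restrictAppIso hU.fromSpec _).hom s := fun n s => by
    rw [smul_restrict_fromSpec hU M _ (fromSpec_image_top hU).le, map_pow]
  refine and_congr ?_ ?_
  · exact forall_congr' fun s => exists_congr fun n => exists_congr fun t =>
      ⟨fun h => h.trans (hs1 n s), fun h => h.trans (hs1 n s).symm⟩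
  · exact forall_congr' fun t => imp_congr Iff.rfl (exists_congr fun n =>
      ⟨fun h => (hs2 n t).symm.trans h, fun h => (hs2 n t).trans h⟩)

lemma localizesAt_basicOpen {U : X.Opens} (hU : IsAffineOpen U) (M : X.Modules)
    (hM : M.IsQuasicoherent) (f : Γ(X, U)) : LocalizesAt M (X.basicOpen_le f) f :=
  (isIso_fromTildeΓ_restrict_iff hU M).1 inferInstance f

/-- Transport of a presentation along an isomorphism. -/
noncomputable def presentationOfIso {M N : X.Modules} (e : M ≅ N) (p : M.Presentation) :
    N.Presentation :=
  @SheafOfModules.Presentation.ofIsIso _ _ _ _ _ _ M N e.hom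
    ((e.isIso_hom : IsIso e.hom)) p

/-- A sheaf whose restriction to each member of an affine cover is of the form `M~` is
quasi-coherent: presentations of the modules give presentations over the members of the cover. -/
lemma isQuasicoherent_of_isIso_fromTildeΓ (M : X.Modules) {ι : Type u} (U : ι → X.Opens)
    (hU : ∀ i, IsAffineOpen (U i)) (hcov : ⨆ i, U i = ⊤)
    (h : ∀ i, IsIso (fromTildeΓ (M.restrict (hU i).fromSpec))) : M.IsQuasicoherent := by
  have hc : (Opens.grothendieckTopology X).CoversTop U := (Opens.coversTop_iff _ _).2 hcov
  have hp : ∀ i, Nonempty (SheafOfModules.Presentation (SheafOfModules.over M (U i))) := by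
    intro i
    have := h i
    let N := M.restrict (hU i).fromSpec
    let p : N.Presentation := presentationOfIso (asIso (fromTildeΓ N))
      (presentationTilde _ .univ (by simp) _ (Submodule.span_eq _))
    let p' := presentationRestrict (hU i).isoSpec.hom p
    let e : ((M.restrict (hU i).fromSpec).restrict (hU i).isoSpec.hom) ≅
        M.restrict (U i).ι :=
      (restrictFunctorComp _ _).symm.app M ≪≫ (restrictFunctorCongr (by simp)).app M
    let q : (M.restrict (U i).ι).Presentation := presentationOfIso e p'
    let F : (U i : Scheme.{u}).Modules ⥤ SheafOfModules.{u} (X.ringCatSheaf.over (U i)) :=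
      (overEquiv (U i)).inverse
    have hF : F.IsLeftAdjoint := by dsimp [F]; exact (overEquiv (U i)).symm.isLeftAdjoint_functor
    have hF' : PreservesColimitsOfSize.{u, u} F := inferInstance
    let η : F.obj (SheafOfModules.unit _) ≅ SheafOfModules.unit _ :=
      (U i).sheafOfModulesEquivOverInverseUnit X.ringCatSheaf
    let q' := @SheafOfModules.Presentation.map _ _ _ _ _ _ _ _ _ _ _ _ _ q F hF' η.symm
    let e' : F.obj (M.restrict (U i).ι) ≅ SheafOfModules.over M (U i) :=
      F.mapIso ((overFunctorEquiv (U i)).symm.app M) ≪≫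
        (overEquiv (U i)).unitIso.symm.app (SheafOfModules.over M (U i))
    exact ⟨@SheafOfModules.Presentation.ofIsIso _ _ _ _ _ _ _ _ e'.hom e'.isIso_hom q'⟩
  exact (SheafOfModules.QuasicoherentData.mk ι U hc (fun i => (hp i).some)).isQuasicoherent

/-! ### Colimits of quasi-coherent sheaves -/

section Spec
variable {R : CommRingCat.{u}} {J : Type w} [Category.{w'} J]
  [∀ R : CommRingCat.{u}, HasColimitsOfShape J (ModuleCat.{u} R)]

/-- A diagram of sheaves on `Spec R` all of which are of the form `M~` is the tilde of its diagram
of global sections. -/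
noncomputable def tildeΓIso (K : J ⥤ (Spec R).Modules) (hK : ∀ j, IsIso (fromTildeΓ (K.obj j))) :
    (K ⋙ moduleSpecΓFunctor) ⋙ tilde.functor R ≅ K :=
  NatIso.ofComponents (fun j => @asIso _ _ _ _ (fromTildeΓ (K.obj j)) (hK j))
    fun f => fromTildeΓNatTrans.naturality (K.map f)

/-- A colimit of sheaves of the form `M~` is again of this form, because `M ↦ M~` is a left
adjoint. -/
lemma isIso_fromTildeΓ_of_isColimit (K : J ⥤ (Spec R).Modules)
    (hK : ∀ j, IsIso (fromTildeΓ (K.obj j))) (c : Cocone K) (hc : IsColimit c) :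
    IsIso (fromTildeΓ c.pt) := by
  let d := colimit.cocone (K ⋙ moduleSpecΓFunctor)
  let hd : IsColimit ((tilde.functor R).mapCocone d) :=
    isColimitOfPreserves (tilde.functor R) (colimit.isColimit _)
  exact isIso_fromTildeΓ_iff.2
    ⟨d.pt, ⟨hd.coconePointsIsoOfNatIso hc (tildeΓIso K hK)⟩⟩

lemma preservesColimit_moduleSpecΓ (K : J ⥤ (Spec R).Modules)
    (hK : ∀ j, IsIso (fromTildeΓ (K.obj j))) :
    PreservesColimit K (moduleSpecΓFunctor (R := R)) := by
  have h1 : PreservesColimit ((K ⋙ moduleSpecΓFunctor) ⋙ tilde.functor R)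
      (moduleSpecΓFunctor (R := R)) := by
    refine preservesColimit_of_preserves_colimit_cocone
      (isColimitOfPreserves (tilde.functor R) (colimit.isColimit (K ⋙ moduleSpecΓFunctor))) ?_
    let e : tilde.functor R ⋙ moduleSpecΓFunctor ≅ 𝟭 _ := tilde.toTildeΓNatIso.symm
    have : PreservesColimit (K ⋙ moduleSpecΓFunctor) (tilde.functor R ⋙ moduleSpecΓFunctor) :=
      preservesColimit_of_natIso _ e.symm
    exact isColimitOfPreserves (tilde.functor R ⋙ moduleSpecΓFunctor)
      (colimit.isColimit (K ⋙ moduleSpecΓFunctor))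
  exact preservesColimit_of_iso_diagram _ (tildeΓIso K hK)

end Spec

lemma isQuasicoherent_iff (M : X.Modules) :
    M.IsQuasicoherent ↔ ∀ (U : X.Opens) (hU : IsAffineOpen U),
      IsIso (fromTildeΓ (M.restrict hU.fromSpec)) := by
  refine ⟨fun h U hU => inferInstance, fun h => ?_⟩
  exact isQuasicoherent_of_isIso_fromTildeΓ M (ι := X.affineOpens) (fun U => U.1) (fun U => U.2)
    (iSup_affineOpens_eq_top X) fun U => h U.1 U.2

/-- Sections over an affine open `U`, as a functor to modules over `Γ(X, U)`. Its underlying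
abelian group is literally that of sections over the image of `Spec Γ(X, U)` in `X`. -/
noncomputable def affineSections {U : X.Opens} (hU : IsAffineOpen U) :
    X.Modules ⥤ ModuleCat Γ(X, U) :=
  restrictFunctor hU.fromSpec ⋙ moduleSpecΓFunctor

lemma isQuasicoherent_of_isColimit {J : Type w} [Category.{w'} J]
    [∀ R : CommRingCat.{u}, HasColimitsOfShape J (ModuleCat.{u} R)] (K : J ⥤ X.Modules)
    (hK : ∀ j, (K.obj j).IsQuasicoherent) (c : Cocone K) (hc : IsColimit c) :
    c.pt.IsQuasicoherent := by
  refine (isQuasicoherent_iff c.pt).2 fun U hU => ?_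
  exact isIso_fromTildeΓ_of_isColimit (K ⋙ restrictFunctor hU.fromSpec)
    (fun j => (isQuasicoherent_iff _).1 (hK j) U hU)
    ((restrictFunctor hU.fromSpec).mapCocone c) (isColimitOfPreserves _ hc)

lemma preservesColimit_affineSections {J : Type w} [Category.{w'} J]
    [∀ R : CommRingCat.{u}, HasColimitsOfShape J (ModuleCat.{u} R)] (K : J ⥤ X.Modules)
    (hK : ∀ j, (K.obj j).IsQuasicoherent) {U : X.Opens} (hU : IsAffineOpen U) :
    PreservesColimit K (affineSections hU) := by
  have := preservesColimit_moduleSpecΓ (K ⋙ restrictFunctor hU.fromSpec)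
    (fun j => (isQuasicoherent_iff _).1 (hK j) U hU)
  exact comp_preservesColimit _ _

/-! ### Sections of coproducts, cokernels and kernels -/

/-- The `Γ(X, U)`-linear map on sections over `U` induced by a morphism of `𝒪_X`-modules. -/
noncomputable def appₗ {M N : X.Modules} (φ : M ⟶ N) (U : X.Opens) :
    Γ(M, U) →ₗ[Γ(X, U)] Γ(N, U) where
  toFun x := φ.app U x
  map_add' x y := map_add _ x y
  map_smul' r x := φ.app_smul r x

lemma appₗ_comp {M N K : X.Modules} (φ : M ⟶ N) (ψ : N ⟶ K) (U : X.Opens) (x : Γ(M, U)) :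
    appₗ (φ ≫ ψ) U x = appₗ ψ U (appₗ φ U x) := rfl

/-- The restriction map on sections, as an additive map. -/
noncomputable def res (M : X.Modules) {V U : X.Opens} (h : V ≤ U) : Γ(M, U) →+ Γ(M, V) :=
  (M.presheaf.map (homOfLE h).op).hom

lemma res_smul (M : X.Modules) {V U : X.Opens} (h : V ≤ U) (r : Γ(X, U)) (x : Γ(M, U)) :
    res M h (r • x) = X.presheaf.map (homOfLE h).op r • res M h x :=
  map_smul M (homOfLE h) r x

lemma res_res (M : X.Modules) {W V U : X.Opens} (h : V ≤ U) (h' : W ≤ V) (x : Γ(M, U)) :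
    res M h' (res M h x) = res M (h'.trans h) x := by
  change ((M.presheaf.map _) ≫ (M.presheaf.map _)) x = _
  rw [← Functor.map_comp]
  rfl

lemma res_self (M : X.Modules) {U : X.Opens} (h : U ≤ U) (x : Γ(M, U)) :
    res M h x = x := by
  change (M.presheaf.map (𝟙 _)) x = _
  rw [CategoryTheory.Functor.map_id]; rfl

lemma appₗ_res {M N : X.Modules} (φ : M ⟶ N) {V U : X.Opens} (h : V ≤ U) (x : Γ(M, U)) :
    appₗ φ V (res M h x) = res N h (appₗ φ U x) :=
  congr($(φ.mapPresheaf.naturality (homOfLE h).op) x)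

lemma eq_of_locally_eq (M : X.Modules) {ι : Type u} (V : ι → X.Opens) (U : X.Opens)
    (hV : ∀ i, V i ≤ U) (hcov : U ≤ ⨆ i, V i) (s t : Γ(M, U))
    (h : ∀ i, res M (hV i) s = res M (hV i) t) : s = t :=
  TopCat.Sheaf.eq_of_locally_eq' ⟨_, M.isSheaf⟩ V U (fun i => homOfLE (hV i)) hcov s t h

/-- Over an affine open, the sections of a coproduct of quasi-coherent sheaves are the finite sums
of sections of the summands. -/
lemma coprod_sections {J : Type u} (P : J → X.Modules) (hP : ∀ j, (P j).IsQuasicoherent)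
    {U : X.Opens} (hU : IsAffineOpen U) (s : Γ(∐ P, U)) :
    s ∈ AddSubgroup.closure {x | ∃ j p, appₗ (Sigma.ι P j) U p = x} := by
  -- The values of `affineSections hU` are sections over `hU.fromSpec ''ᵁ ⊤`, which equals `U`, but
  -- not by definition.
  suffices H : ∀ V : X.Opens, V = hU.fromSpec ''ᵁ ⊤ → ∀ s : Γ(∐ P, V),
      s ∈ AddSubgroup.closure {x | ∃ j p, appₗ (Sigma.ι P j) V p = x} from
    H U (fromSpec_image_top hU).symm s
  rintro _ rfl s
  have := preservesColimit_affineSections (Discrete.functor P) (fun j => hP j.as) hU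
  have hc := isColimitOfPreserves (affineSections hU) (colimit.isColimit (Discrete.functor P))
  let Q : Submodule Γ(X, U) ((affineSections hU).obj (∐ P)) :=
    ⨆ j, LinearMap.range ((affineSections hU).map (Sigma.ι P j)).hom
  have hQ : Q = ⊤ := by
    have : (ModuleCat.ofHom Q.mkQ) = 0 := by
      refine hc.hom_ext fun j => ?_
      ext x
      change Q.mkQ (((affineSections hU).map (Sigma.ι P j.as)).hom x) = 0
      rw [Submodule.mkQ_apply, Submodule.Quotient.mk_eq_zero]
      exact Submodule.mem_iSup_of_mem j.as ⟨x, rfl⟩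
    rw [← Submodule.ker_mkQ Q, LinearMap.ker_eq_top]
    exact congr(ModuleCat.Hom.hom $this)
  let s' : (affineSections hU).obj (∐ P) := s
  let G : AddSubgroup ((affineSections hU).obj (∐ P)) :=
    AddSubgroup.closure {x | ∃ j p, ((affineSections hU).map (Sigma.ι P j)).hom p = x}
  have hs : s' ∈ Q := hQ ▸ Submodule.mem_top
  have key : s' ∈ G := by
    refine Submodule.iSup_induction _ (motive := fun x => x ∈ G) hs ?_ G.zero_mem
      fun x y hx hy => G.add_mem hx hy
    rintro j _ ⟨y, rfl⟩
    exact AddSubgroup.subset_closure ⟨j, y, rfl⟩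
  exact key

instance {U : X.Opens} (hU : IsAffineOpen U) : (affineSections hU).PreservesZeroMorphisms :=
  ⟨fun _ _ => rfl⟩

/-- Sections over an affine open preserve cokernels of quasi-coherent sheaves. -/
lemma cokernel_sections {M N C : X.Modules} (hM : M.IsQuasicoherent) (hN : N.IsQuasicoherent)
    (f : M ⟶ N) (g : N ⟶ C) (w : f ≫ g = 0) (hc : IsColimit (CokernelCofork.ofπ g w))
    {U : X.Opens} (hU : IsAffineOpen U) :
    Function.Surjective (appₗ g U) ∧ Function.Exact (appₗ f U) (appₗ g U) := by
  -- The values of `affineSections hU` are sections over `hU.fromSpec ''ᵁ ⊤`, which equals `U`, but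
  -- not by definition.
  suffices H : ∀ V : X.Opens, V = hU.fromSpec ''ᵁ ⊤ →
      Function.Surjective (appₗ g V) ∧ Function.Exact (appₗ f V) (appₗ g V) from
    H U (fromSpec_image_top hU).symm
  rintro _ rfl
  have := preservesColimit_affineSections (parallelPair f 0)
    (by rintro (_ | _) <;> assumption) hU
  have hc' := CokernelCofork.mapIsColimit _ hc (affineSections hU)
  have hex : (ShortComplex.mk ((affineSections hU).map f) ((affineSections hU).map g)
      (by rw [← Functor.map_comp, w, Functor.map_zero])).Exact :=
    ShortComplex.exact_of_g_is_cokernel _ hc'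
  have hepi : Epi ((affineSections hU).map g) := epi_of_isColimit_cofork hc'
  have hs := (ModuleCat.epi_iff_surjective ((affineSections hU).map g)).1 hepi
  have he := (ShortComplex.ShortExact.moduleCat_exact_iff_function_exact _).1 hex
  exact ⟨fun x => hs x, fun y => he y⟩

lemma isQuasicoherent_cokernel {M N C : X.Modules} (hM : M.IsQuasicoherent)
    (hN : N.IsQuasicoherent)
    (f : M ⟶ N) (g : N ⟶ C) (w : f ≫ g = 0) (hc : IsColimit (CokernelCofork.ofπ g w)) :
    C.IsQuasicoherent :=
  isQuasicoherent_of_isColimit (parallelPair f 0) (by rintro (_ | _) <;> assumption) _ hc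

lemma isQuasicoherent_coprod {J : Type u} (P : J → X.Modules)
    (hP : ∀ j, (P j).IsQuasicoherent) : (∐ P).IsQuasicoherent :=
  isQuasicoherent_of_isColimit (Discrete.functor P) (fun j => hP j.as) _
    (colimit.isColimit (Discrete.functor P))

lemma surjective_of_epi {M N : X.Modules} (hM : M.IsQuasicoherent)
    (hN : N.IsQuasicoherent) (f : M ⟶ N) [Epi f]
    {U : X.Opens} (hU : IsAffineOpen U) : Function.Surjective (appₗ f U) := by
  have h := (cokernel_sections hM hN f _ (cokernel.condition f) (cokernelIsCokernel f) hU).2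
  intro x
  refine (h x).1 ?_
  rw [cokernel.π_of_epi]
  rfl

lemma kernel_sections {K M N : X.Modules} (i : K ⟶ M) (f : M ⟶ N) (w : i ≫ f = 0)
    (hl : IsLimit (KernelFork.ofι i w)) (U : X.Opens) :
    Function.Injective (appₗ i U) ∧ Function.Exact (appₗ i U) (appₗ f U) := by
  let F : X.Modules ⥤ AddCommGrpCat.{u} :=
    toPresheaf X ⋙ (CategoryTheory.evaluation _ _).obj (Opposite.op U)
  have : F.PreservesZeroMorphisms := ⟨fun _ _ => rfl⟩
  have : PreservesLimitsOfSize.{u, u} ((CategoryTheory.evaluation (X.Opens)ᵒᵖ AddCommGrpCat.{u}).obj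
    (Opposite.op U)) := ⟨fun {J} _ => evaluation_preservesLimitsOfShape _⟩
  have : PreservesLimitsOfSize.{u, u} F := comp_preservesLimits (toPresheaf X) _
  have : PreservesLimitsOfSize.{0, 0} F := preservesLimitsOfSize_shrink F
  have hl' := KernelFork.mapIsLimit _ hl F
  have hex : (ShortComplex.mk (F.map i) (F.map f)
      (by rw [← Functor.map_comp, w, Functor.map_zero])).Exact :=
    ShortComplex.exact_of_f_is_kernel _ hl'
  have hmono : Mono (F.map i) := mono_of_isLimit_fork hl'
  have hs := (AddCommGrpCat.mono_iff_injective (F.map i)).1 hmono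
  have he := (ShortComplex.ab_exact_iff_function_exact _).1 hex
  exact ⟨fun x y h => hs h, fun y => he y⟩

lemma isQuasicoherent_iff_localizesAt (M : X.Modules) :
    M.IsQuasicoherent ↔ ∀ U : X.Opens, IsAffineOpen U →
      ∀ f : Γ(X, U), LocalizesAt M (X.basicOpen_le f) f :=
  (isQuasicoherent_iff M).trans (forall_congr' fun _ => forall_congr' fun hU =>
    isIso_fromTildeΓ_restrict_iff hU M)

/-- Kernels of maps between quasi-coherent sheaves are quasi-coherent, by left exactness of
sections and the elementwise description of localization. -/
lemma isQuasicoherent_kernel {K M N : X.Modules} (hM : M.IsQuasicoherent)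
    (hN : N.IsQuasicoherent) (i : K ⟶ M) (f : M ⟶ N) (w : i ≫ f = 0)
    (hl : IsLimit (KernelFork.ofι i w)) : K.IsQuasicoherent := by
  refine (isQuasicoherent_iff_localizesAt K).2 fun U hU r => ⟨fun s => ?_, fun t ht => ?_⟩
  · obtain ⟨n, t, ht⟩ := (localizesAt_basicOpen hU M hM r).1 (appₗ i _ s)
    obtain ⟨m, hm⟩ := (localizesAt_basicOpen hU N hN r).2 (appₗ f U t) (by
      change res N _ (appₗ f U t) = 0
      rw [← appₗ_res]
      change appₗ f _ (M.presheaf.map _ t) = 0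
      rw [ht, LinearMap.map_smul, (kernel_sections i f w hl _).2.apply_apply_eq_zero, smul_zero])
    obtain ⟨t', ht'⟩ := ((kernel_sections i f w hl U).2 (r ^ m • t)).1 (by
      rw [LinearMap.map_smul, hm])
    refine ⟨m + n, t', (kernel_sections i f w hl _).1 ?_⟩
    change appₗ i _ (res K _ t') = _
    rw [appₗ_res, ht', res_smul, LinearMap.map_smul, pow_add, mul_smul, map_pow]
    exact congrArg _ ht
  · obtain ⟨n, hn⟩ := (localizesAt_basicOpen hU M hM r).2 (appₗ i _ t) (by
      change res M _ (appₗ i U t) = 0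
      rw [← appₗ_res]
      change appₗ i _ (K.presheaf.map _ t) = 0
      rw [ht, map_zero])
    exact ⟨n, (kernel_sections i f w hl _).1 (by rw [LinearMap.map_smul, hn, map_zero])⟩

lemma isQuasicoherent_pushforward {Y : Scheme.{u}} (j : Y ⟶ X)
    (hj : ∀ U : X.Opens, IsAffineOpen U → IsAffineOpen (j ⁻¹ᵁ U)) (M : Y.Modules)
    (hM : M.IsQuasicoherent) : ((pushforward j).obj M).IsQuasicoherent := by
  refine (isQuasicoherent_iff_localizesAt _).2 fun U hU r => ?_
  have h := localizesAt_basicOpen (hj U hU) M hM (j.app U r)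
  have key : LocalizesAt M (j.preimage_mono (X.basicOpen_le r)) (j.app U r) := by
    have e : j ⁻¹ᵁ (X.basicOpen r) = Y.basicOpen (j.app U r) := Scheme.preimage_basicOpen j r
    have := (localizesAt_congr M (Y.basicOpen_le (j.app U r))
      (j.preimage_mono (X.basicOpen_le r)) rfl e (j.app U r)).2 h
    rwa [show Y.presheaf.map (homOfLE (le_refl (j ⁻¹ᵁ U))).op (j.app U r) = j.app U r from
      congr($(Y.presheaf.map_id _) (j.app U r))] at this
  refine ⟨fun s => ?_, fun t ht => ?_⟩
  · obtain ⟨n, t, ht⟩ := key.1 s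
    refine ⟨n, t, ht.trans ?_⟩
    have : Y.presheaf.map (homOfLE (j.preimage_mono (X.basicOpen_le r))).op (j.app U r) =
      j.app _ (X.presheaf.map (homOfLE (X.basicOpen_le r)).op r) :=
      congr($(j.naturality (homOfLE (X.basicOpen_le r)).op) r).symm
    rw [this, ← map_pow]
    rfl
  · obtain ⟨n, hn⟩ := key.2 t ht
    refine ⟨n, ?_⟩
    rw [← map_pow] at hn
    exact hn

/-! ### Properties checked on an affine cover -/

/-- The `Γ(X, U)`-module structure on sections over the basic open of `f : Γ(X, U)`, by
restriction of scalars. -/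
noncomputable instance moduleBasicOpen (M : X.Modules) {U : X.Opens} (f : Γ(X, U)) :
    Module Γ(X, U) Γ(M, X.basicOpen f) :=
  Module.compHom _ (algebraMap Γ(X, U) Γ(X, X.basicOpen f))

instance (M : X.Modules) {U : X.Opens} (f : Γ(X, U)) :
    IsScalarTower Γ(X, U) Γ(X, X.basicOpen f) Γ(M, X.basicOpen f) :=
  .of_algebraMap_smul fun _ _ ↦ rfl

/-- Restriction of sections from `U` to the basic open of `f`, as a `Γ(X, U)`-linear map. -/
noncomputable def resₗ (M : X.Modules) {U : X.Opens} (f : Γ(X, U)) :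
    Γ(M, U) →ₗ[Γ(X, U)] Γ(M, X.basicOpen f) where
  toFun := res M (X.basicOpen_le f)
  map_add' := map_add _
  map_smul' r x := res_smul M _ r x

lemma isLocalizedModule_resₗ (M : X.Modules) (hM : M.IsQuasicoherent) {U : X.Opens}
    (hU : IsAffineOpen U) (f : Γ(X, U)) : IsLocalizedModule.Away f (resₗ M f) := by
  have hloc := hU.isLocalization_basicOpen f
  have hl := localizesAt_basicOpen hU M hM f
  refine IsLocalizedModule.Away.mk_of_addCommGroup ?_ ?_ ?_
  · have h1 : IsUnit (algebraMap Γ(X, U) Γ(X, X.basicOpen f) f) :=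
      IsLocalization.Away.algebraMap_isUnit f
    have h2 := h1.map (algebraMap _ (Module.End Γ(X, X.basicOpen f) Γ(M, X.basicOpen f)))
    rw [Module.End.isUnit_iff] at h2 ⊢
    exact h2
  · intro s
    obtain ⟨n, t, ht⟩ := hl.1 s
    refine ⟨n, t, ?_⟩
    refine Eq.trans ?_ ht.symm
    rw [← map_pow]
    rfl
  · intro t ht
    exact hl.2 t ht

lemma flat_of_cover (M : X.Modules) (hM : M.IsQuasicoherent) {ι : Type*} (U : ι → X.affineOpens)
    (hcov : (⨆ i, U i : X.Opens) = ⊤) (h : ∀ i, Module.Flat Γ(X, U i) Γ(M, U i))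
    (V : X.affineOpens) : Module.Flat Γ(X, V) Γ(M, V) := by
  refine of_affine_open_cover (P := fun U => Module.Flat Γ(X, U) Γ(M, U)) U hcov V
    (fun W f hW => ?_) (fun W s hs hW => ?_) h
  · have := W.2.isLocalization_basicOpen f
    have := isLocalizedModule_resₗ M hM W.2 f
    change Module.Flat Γ(X, X.basicOpen f) Γ(M, X.basicOpen f)
    change Module.Flat Γ(X, W) Γ(M, W) at hW
    exact Module.Flat.of_isLocalizedModule Γ(X, X.basicOpen f) (.powers f) (resₗ M f)
  · have (r : (s : Set Γ(X, W))) := isLocalizedModule_resₗ M hM W.2 r.1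
    refine Module.flat_of_isLocalized_span Γ(X, W) Γ(M, W) (s : Set Γ(X, W)) hs
      (fun r => Γ(M, X.basicOpen r.1)) (fun r => resₗ M r.1) fun r => ?_
    have := W.2.isLocalization_basicOpen r.1
    exact (Module.flat_iff_of_isLocalization Γ(X, X.basicOpen r.1) (.powers r.1)
      Γ(M, X.basicOpen r.1)).1
      (hW r)

lemma finite_of_cover (M : X.Modules) (hM : M.IsQuasicoherent) {ι : Type*}
    (U : ι → X.affineOpens)
    (hcov : (⨆ i, U i : X.Opens) = ⊤) (h : ∀ i, Module.Finite Γ(X, U i) Γ(M, U i))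
    (V : X.affineOpens) : Module.Finite Γ(X, V) Γ(M, V) := by
  refine of_affine_open_cover (P := fun U => Module.Finite Γ(X, U) Γ(M, U)) U hcov V
    (fun W f hW => ?_) (fun W s hs hW => ?_) h
  · have := W.2.isLocalization_basicOpen f
    have := isLocalizedModule_resₗ M hM W.2 f
    change Module.Finite Γ(X, X.basicOpen f) Γ(M, X.basicOpen f)
    change Module.Finite Γ(X, W) Γ(M, W) at hW
    exact Module.Finite.of_isLocalizedModule (.powers f) (Rₚ := Γ(X, X.basicOpen f)) (resₗ M f)
  · have (r : s) := isLocalizedModule_resₗ M hM W.2 r.1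
    have (r : s) := W.2.isLocalization_basicOpen r.1
    exact Module.Finite.of_localizationSpan_finite' s hs
      (Mₚ := fun r => Γ(M, X.basicOpen r.1)) (Rₚ := fun r => Γ(X, X.basicOpen r.1))
      (fun r => resₗ M r.1) hW

lemma subsingleton_of_cover (M : X.Modules) (hM : M.IsQuasicoherent) {ι : Type*}
    (U : ι → X.affineOpens)
    (hcov : (⨆ i, U i : X.Opens) = ⊤) (h : ∀ i, Subsingleton Γ(M, U i))
    (V : X.Opens) : Subsingleton Γ(M, V) := by
  have key : ∀ V : X.affineOpens, Subsingleton Γ(M, V) := fun V => by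
    refine of_affine_open_cover (P := fun U => Subsingleton Γ(M, U)) U hcov V
      (fun W f hW => ?_) (fun W s hs hW => ?_) h
    · have := isLocalizedModule_resₗ M hM W.2 f
      change Subsingleton Γ(M, X.basicOpen f)
      refine subsingleton_of_forall_eq 0 fun x => ?_
      obtain ⟨n, t, ht⟩ := IsLocalizedModule.Away.surj (r := f) (resₗ M f) x
      rw [Subsingleton.elim t 0, map_zero] at ht
      have hu := (IsLocalizedModule.Away.isUnit_algebraMap (r := f) (resₗ M f)).pow n
      rw [← map_pow, Module.End.isUnit_iff] at hu
      exact hu.injective (ht.trans (map_zero _).symm)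
    · refine subsingleton_of_forall_eq 0 fun x => ?_
      have : x ∈ (⊥ : Submodule Γ(X, W) Γ(M, W)) := by
        refine Submodule.mem_of_span_eq_top_of_smul_pow_mem _ _ hs _ fun r => ?_
        have := isLocalizedModule_resₗ M hM W.2 r.1
        have := hW r
        obtain ⟨n, hn⟩ := IsLocalizedModule.Away.exists_of_eq r.1 (f := resₗ M r.1) (x := x)
          (y := 0) (@Subsingleton.elim _ this _ _)
        exact ⟨n, by simpa using hn⟩
      simpa using this
  refine subsingleton_of_forall_eq 0 fun x => ?_
  refine eq_of_locally_eq M (ι := {W : X.affineOpens // W.1 ≤ V}) (fun W => W.1.1) V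
    (fun W => W.2) ?_ x 0 fun W => @Subsingleton.elim _ (key W.1) _ _
  intro x hx
  obtain ⟨W, hW, hxW, hWV⟩ := X.isBasis_affineOpens.exists_subset_of_mem_open hx V.2
  obtain ⟨W, hW, rfl⟩ := hW
  exact TopologicalSpace.Opens.mem_iSup.2 ⟨⟨⟨W, hW⟩, hWV⟩, hxW⟩

lemma epi_of_cover {M N : X.Modules} (hM : M.IsQuasicoherent) (hN : N.IsQuasicoherent)
    (φ : M ⟶ N) {ι : Type*}
    (U : ι → X.affineOpens) (hcov : (⨆ i, U i : X.Opens) = ⊤)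
    (h : ∀ i, Function.Surjective (appₗ φ (U i))) : Epi φ := by
  have hc := cokernelIsCokernel φ
  have hC := isQuasicoherent_cokernel hM hN φ _ (cokernel.condition φ) hc
  have hz := subsingleton_of_cover (cokernel φ) hC U hcov fun i => by
    obtain ⟨h1, h2⟩ := cokernel_sections hM hN φ _ (cokernel.condition φ) hc (U i).2
    refine subsingleton_of_forall_eq 0 fun x => ?_
    obtain ⟨y, rfl⟩ := h1 x
    exact (h2 y).2 (h i y)
  refine Abelian.epi_of_cokernel_π_eq_zero φ ?_
  refine hom_ext _ _ fun V => ?_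
  ext x
  exact @Subsingleton.elim _ (hz V) _ _

/-! ### Countable approximation of flat modules -/

section Algebra

variable {R : Type*} [CommRing R] {M : Type*} [AddCommGroup M] [Module R M]

/-- If `M` is flat, the first `n` of a countable family of relations between the images of the
basis vectors become trivial in a finite free module through which the first `n` images factor. -/
lemma exists_factor_of_flat [Module.Flat R M] (x : (ℕ →₀ R) →ₗ[R] M) (r : ℕ → ℕ →₀ R)
    (hr : ∀ i, x (r i) = 0) (n : ℕ) :
    ∃ (l : ℕ) (c : (ℕ →₀ R) →ₗ[R] (Fin l →₀ R)) (y : (Fin l →₀ R) →ₗ[R] M),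
      (∀ i < n, c (r i) = 0) ∧
        ∀ j < n, y (c (Finsupp.single j 1)) = x (Finsupp.single j 1) := by
  obtain ⟨N, hnN, hN⟩ : ∃ N, n ≤ N ∧ ∀ i < n, ∀ j ∈ (r i).support, j < N := by
    let s : Finset ℕ := Finset.range n ∪ (Finset.range n).biUnion fun i => (r i).support
    refine ⟨s.sup id + 1, ?_, fun i hi j hj => ?_⟩
    · rcases n with _ | n
      · exact Nat.zero_le _
      · have : n ∈ s := Finset.mem_union_left _ (Finset.self_mem_range_succ n)
        exact Nat.succ_le_succ (Finset.le_sup (f := id) this)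
    · have : j ∈ s := Finset.mem_union_right _
        (Finset.mem_biUnion.2 ⟨i, Finset.mem_range.2 hi, hj⟩)
      exact Nat.lt_succ_of_le (Finset.le_sup (f := id) this)
  let e : (Fin N →₀ R) →ₗ[R] (ℕ →₀ R) := Finsupp.lmapDomain R R Fin.val
  let p : (ℕ →₀ R) →ₗ[R] (Fin N →₀ R) := Finsupp.lcomapDomain Fin.val Fin.val_injective
  have hep : ∀ z : ℕ →₀ R, (∀ j ∈ z.support, j < N) → e (p z) = z := fun z hz =>
    Finsupp.mapDomain_comapDomain _ Fin.val_injective z fun j hj => ⟨⟨j, hz j hj⟩, rfl⟩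
  let f : (Fin n →₀ R) →ₗ[R] (Fin N →₀ R) :=
    Finsupp.linearCombination R fun i : Fin n => p (r i)
  have hf : (x ∘ₗ e) ∘ₗ f = 0 := by
    ext i
    simp [f, hep (r i) (hN i i.2), hr]
  obtain ⟨l, a, y, hay, ha⟩ := Module.Flat.exists_factorization_of_comp_eq_zero_of_free hf
  refine ⟨l, a ∘ₗ p, y, fun i hi => ?_, fun j hj => ?_⟩
  · simpa [f] using congr($ha (Finsupp.single ⟨i, hi⟩ 1))
  · have h := congr($hay (p (Finsupp.single j 1)))
    simp only [LinearMap.comp_apply] at h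
    rw [LinearMap.comp_apply, ← h, hep]
    intro i hi
    have := Finsupp.support_single_subset hi
    simp only [Finset.mem_singleton] at this
    omega

/-- A linear map sends `e` into `S` as soon as it sends the basis vectors in the support of `e`
into `S`. -/
lemma apply_mem_of_forall_single_mem {κ : Type*} (v : (κ →₀ R) →ₗ[R] M) (S : Submodule R M)
    (e : κ →₀ R) (h : ∀ i ∈ e.support, v (Finsupp.single i 1) ∈ S) : v e ∈ S := by
  rw [← Finsupp.sum_single e, Finsupp.sum, map_sum]
  refine Submodule.sum_mem _ fun i hi => ?_
  rw [← Finsupp.smul_single_one, _root_.map_smul]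
  exact S.smul_mem _ (h i hi)

lemma exists_bound_support (e : ℕ →₀ R) : ∃ n : ℕ, ∀ i ∈ e.support, i < n :=
  ⟨e.support.sup id + 1, fun _ hi => Nat.lt_succ_of_le (Finset.le_sup (f := id) hi)⟩

lemma exists_bound_support_range {k : ℕ} (v : (Fin k →₀ R) →ₗ[R] (ℕ →₀ R)) :
    ∃ n : ℕ, ∀ e, ∀ i ∈ (v e).support, i < n := by
  choose m hm using fun i : Fin k => exists_bound_support (v (Finsupp.single i 1))
  refine ⟨Finset.univ.sup m, fun e => ?_⟩
  have : v e ∈ Finsupp.supported R R (Set.Iio (Finset.univ.sup m)) :=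
    apply_mem_of_forall_single_mem v _ e fun i _ j hj =>
      (hm i j hj).trans_le (Finset.le_sup (Finset.mem_univ i))
  exact fun i hi => this hi

/-- The relative form of the equational criterion for flatness of `A / B`, with an enlargement
`A' / B'` as the target: whenever `v : Rᵏ → A` sends `w` into `B`, the map `v` agrees modulo `B'`
with a composite `Rᵏ → Rˡ → A'` whose first factor kills `w`. -/
def FactorsThroughFree {P : Type*} [AddCommGroup P] [Module R P] (A B A' B' : Submodule R P) :
    Prop :=
  ∀ (k : ℕ) (v : (Fin k →₀ R) →ₗ[R] P) (w : Fin k →₀ R), (∀ e, v e ∈ A) → v w ∈ B →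
    ∃ (l : ℕ) (a : (Fin k →₀ R) →ₗ[R] (Fin l →₀ R)) (y : (Fin l →₀ R) →ₗ[R] P),
      (∀ e, y e ∈ A') ∧ a w = 0 ∧ ∀ e, v e - y (a e) ∈ B'

lemma IsCountablyGenerated.exists_nat (h : IsCountablyGenerated R M) :
    ∃ g : ℕ → M, Submodule.span R (Set.range g) = ⊤ := by
  obtain ⟨s, hs, hspan⟩ := h
  rcases s.eq_empty_or_nonempty with rfl | hne
  · exact ⟨0, top_le_iff.1 (hspan ▸ by simp)⟩
  · obtain ⟨g, rfl⟩ := hs.exists_eq_range hne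
    exact ⟨g, hspan⟩

lemma exists_nat_span_eq (B : Submodule R M) (h : IsCountablyGenerated R B) :
    ∃ g : ℕ → M, Submodule.span R (Set.range g) = B := by
  obtain ⟨g, hg⟩ := h.exists_nat
  refine ⟨fun i => g i, ?_⟩
  have := congrArg (Submodule.map B.subtype) hg
  rwa [Submodule.map_span, Submodule.map_subtype_top, ← Set.range_comp] at this

/-- If `P / C` is flat, then for countably generated `B ≤ A ⊓ C` the factorizations provided by
the equational criterion only use countable subsets of `P` and of `C`. Projectivity of `A` allows
to lift maps from finite free modules to `A` along a countable free cover of `A`. -/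
lemma exists_countable_factorsThroughFree {P : Type*} [AddCommGroup P] [Module R P]
    (A B C : Submodule R P) [Module.Flat R (P ⧸ C)] [Module.Projective R A]
    (hA : IsCountablyGenerated R A) (hB : IsCountablyGenerated R B) (hBA : B ≤ A) (hBC : B ≤ C) :
    ∃ α β : Set P, α.Countable ∧ β.Countable ∧ β ⊆ C ∧
      ∀ A' B' : Submodule R P, α ⊆ A' → β ⊆ B' → FactorsThroughFree A B A' B' := by
  obtain ⟨g, hg⟩ := hA.exists_nat
  obtain ⟨b, hb⟩ := exists_nat_span_eq B hB
  have hbB : ∀ i, b i ∈ B := fun i => hb ▸ Submodule.subset_span ⟨i, rfl⟩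
  let π : (ℕ →₀ R) →ₗ[R] A := Finsupp.linearCombination R g
  have hπ : Function.Surjective π := by
    rw [← LinearMap.range_eq_top, Finsupp.range_linearCombination, hg]
  obtain ⟨σ, hσ⟩ := Module.projective_lifting_property π LinearMap.id hπ
  have hσ' : ∀ z, π (σ z) = z := fun z => congr($hσ z)
  let b' : ℕ → A := fun i => ⟨b i, hBA (hbB i)⟩
  let x : (ℕ →₀ R) →ₗ[R] (P ⧸ C) := C.mkQ ∘ₗ A.subtype ∘ₗ π
  have hx : ∀ i, x (σ (b' i)) = 0 := fun i => by
    simp only [x, LinearMap.comp_apply, hσ']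
    exact (Submodule.Quotient.mk_eq_zero _).2 (hBC (hbB i))
  choose l c y hc hy using fun n => exists_factor_of_flat x (fun i => σ (b' i)) hx n
  choose y' hy' using fun n => Module.projective_lifting_property C.mkQ (y n) C.mkQ_surjective
  refine ⟨⋃ n, Set.range fun i => y' n (Finsupp.single i 1),
    ⋃ n, (fun j => (π (Finsupp.single j 1) : P) - y' n (c n (Finsupp.single j 1))) '' Set.Iio n,
    Set.countable_iUnion fun n => Set.countable_range _,
    Set.countable_iUnion fun n => (Set.to_countable _).image _, ?_, ?_⟩
  · rintro _ ⟨_, ⟨n, rfl⟩, j, hj, rfl⟩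
    rw [SetLike.mem_coe, ← Submodule.Quotient.mk_eq_zero, Submodule.Quotient.mk_sub, sub_eq_zero]
    have h := congr($(hy' n) (c n (Finsupp.single j 1)))
    rw [hy n j hj] at h
    exact h.symm
  · intro A' B' hα hβ k v w hv hw
    let v' : (Fin k →₀ R) →ₗ[R] (ℕ →₀ R) := σ ∘ₗ v.codRestrict A hv
    have hv' : ∀ e, (π (v' e) : P) = v e := fun e => by
      simp only [v', LinearMap.comp_apply, hσ', LinearMap.codRestrict_apply]
    obtain ⟨n₁, hn₁⟩ := exists_bound_support_range v'
    obtain ⟨d, hd⟩ : ∃ d : ℕ →₀ R, Finsupp.linearCombination R b' d = v.codRestrict A hv w := by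
      obtain ⟨d, hd⟩ := (Finsupp.range_linearCombination (R := R) (v := b)).ge (hb.ge hw)
      refine ⟨d, Subtype.ext ?_⟩
      change A.subtype (Finsupp.linearCombination R b' d) = v w
      rw [← hd, Finsupp.apply_linearCombination]
      rfl
    obtain ⟨n₂, hn₂⟩ := exists_bound_support d
    let n := max n₁ n₂
    refine ⟨l n, c n ∘ₗ v', y' n, fun e => ?_, ?_, fun e => ?_⟩
    · refine apply_mem_of_forall_single_mem _ _ e fun i _ => hα ?_
      exact Set.mem_iUnion.2 ⟨n, i, rfl⟩
    · have : ((c n) ∘ₗ σ ∘ₗ Finsupp.linearCombination R b') d ∈ (⊥ : Submodule R _) := by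
        refine apply_mem_of_forall_single_mem _ _ d fun i hi => ?_
        simpa using hc n i ((hn₂ i hi).trans_le (le_max_right _ _))
      simpa [hd, v'] using this
    · have : (A.subtype ∘ₗ π - y' n ∘ₗ c n) (v' e) ∈ B' := by
        refine apply_mem_of_forall_single_mem _ _ _ fun i hi => hβ ?_
        exact Set.mem_iUnion.2 ⟨n, i, (hn₁ e i hi).trans_le (le_max_left _ _), rfl⟩
      simpa [hv'] using this

/-- If each step of a chain of pairs `B n ≤ A n` trivializes the relations of the previous one,
then the quotient `D` of `⋃ A n` by `⋃ B n` is flat. The union of the `A n` is presented as the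
range of an arbitrary map `ι`, which need not be injective. -/
lemma flat_of_chain {P D A₀ : Type*} [AddCommGroup P] [Module R P] [AddCommGroup D] [Module R D]
    [AddCommGroup A₀] [Module R A₀] (A B : ℕ → Submodule R P) (hA : Monotone A) (hB : Monotone B)
    (h : ∀ n, FactorsThroughFree (A n) (B n) (A (n + 1)) (B (n + 1)))
    (ι : A₀ →ₗ[R] P) (hι : LinearMap.range ι = ⨆ n, A n)
    (g : A₀ →ₗ[R] D) (hg : Function.Surjective g) (hgB : ∀ a, g a = 0 ↔ ι a ∈ ⨆ n, B n) :
    Module.Flat R D := by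
  refine Module.Flat.of_forall_exists_factorization fun {k f x} hxf => ?_
  obtain ⟨v₀, hv₀⟩ := Module.projective_lifting_property g x hg
  have hv₀' : ∀ e, g (v₀ e) = x e := fun e => congr($hv₀ e)
  have hmA : ∀ e, ι (v₀ e) ∈ ⨆ n, A n := fun e => hι ▸ ⟨_, rfl⟩
  choose m hm using fun i : Fin k =>
    (Submodule.mem_iSup_of_directed A hA.directed_le).1 (hmA (Finsupp.single i 1))
  obtain ⟨m', hm'⟩ := (Submodule.mem_iSup_of_directed B hB.directed_le).1
    ((hgB (v₀ f)).1 (by rw [hv₀', hxf]))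
  let n := max (Finset.univ.sup m) m'
  obtain ⟨l, a, y, hy, haf, hay⟩ := h n k (ι ∘ₗ v₀) f
    (fun e => apply_mem_of_forall_single_mem _ _ e fun i _ =>
      hA ((Finset.le_sup (Finset.mem_univ i)).trans (le_max_left _ _)) (hm i))
    (hB (le_max_right _ _) hm')
  have hyr : ∀ e, y e ∈ LinearMap.range ι := fun e => hι ▸ Submodule.mem_iSup_of_mem _ (hy e)
  obtain ⟨y₀, hy₀⟩ := Module.projective_lifting_property ι.rangeRestrict (y.codRestrict _ hyr)
    ι.surjective_rangeRestrict
  have hy₀' : ∀ e, ι (y₀ e) = y e := fun e => congr(($hy₀ e : P))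
  refine ⟨l, a, g ∘ₗ y₀, ?_, haf⟩
  ext1 i
  ext
  have : g (v₀ (Finsupp.single i 1) - y₀ (a (Finsupp.single i 1))) = 0 := by
    rw [hgB, map_sub, hy₀']
    exact Submodule.mem_iSup_of_mem _ (hay _)
  rw [map_sub, sub_eq_zero, hv₀'] at this
  simpa using this

end Algebra

/-! ### Projective dimension of countably presented flat modules -/

section Algebra

variable {R : Type*} [CommRing R] {M : Type*} [AddCommGroup M] [Module R M]

/-- Part of Schanuel's lemma: if one projective presentation of `M` has projective kernel, then so
has every other one. The kernel of `π` is a direct summand of `P × ker π'`. -/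
lemma projective_ker_of_projective_ker {P P' : Type*} [AddCommGroup P] [Module R P]
    [AddCommGroup P'] [Module R P'] [Module.Projective R P] [Module.Projective R P']
    (π : P →ₗ[R] M) (hπ : Function.Surjective π) (π' : P' →ₗ[R] M) (hπ' : Function.Surjective π')
    [Module.Projective R (LinearMap.ker π')] : Module.Projective R (LinearMap.ker π) := by
  obtain ⟨α, hα⟩ := Module.projective_lifting_property π π' hπ
  obtain ⟨β, hβ⟩ := Module.projective_lifting_property π' π hπ'
  have hα' : ∀ z, π (α z) = π' z := fun z => congr($hα z)
  have hβ' : ∀ z, π' (β z) = π z := fun z => congr($hβ z)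
  let i : LinearMap.ker π →ₗ[R] P × LinearMap.ker π' :=
    LinearMap.prod (LinearMap.ker π).subtype
      ((β ∘ₗ (LinearMap.ker π).subtype).codRestrict _ fun k => by
        simp [hβ'])
  let p : P × LinearMap.ker π' →ₗ[R] LinearMap.ker π :=
    LinearMap.codRestrict _ (LinearMap.coprod (LinearMap.id - α ∘ₗ β)
      (α ∘ₗ (LinearMap.ker π').subtype)) fun z => by
        simp [hα', hβ']
  refine Module.Projective.of_split i p ?_
  refine LinearMap.ext fun k => Subtype.ext ?_
  change ((k : P) - α (β k)) + α (β k) = k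
  simp

section Telescope

variable {L : ℕ → Type*} [∀ k, AddCommGroup (L k)] [∀ k, Module R (L k)]
  (a : ∀ k, L k →ₗ[R] L (k + 1)) (y : ∀ k, L k →ₗ[R] M)

open DirectSum

/-- The map `⨁ L k → ⨁ L k` sending `z` in degree `k` to `z - a k z`, whose cokernel is the
colimit of the sequence `L 0 → L 1 → ⋯`. -/
noncomputable def telescope : (⨁ k, L k) →ₗ[R] (⨁ k, L k) :=
  DirectSum.toModule R ℕ _ fun k =>
    DirectSum.lof R ℕ L k - DirectSum.lof R ℕ L (k + 1) ∘ₗ a k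

lemma telescope_lof (k : ℕ) (z : L k) : telescope a (DirectSum.lof R ℕ L k z) =
    DirectSum.lof R ℕ L k z - DirectSum.lof R ℕ L (k + 1) (a k z) := by
  simp [telescope]

lemma telescope_apply_zero (t : ⨁ k, L k) : telescope a t 0 = t 0 := by
  have : DirectSum.component R ℕ L 0 ∘ₗ telescope a = DirectSum.component R ℕ L 0 := by
    refine DirectSum.linearMap_ext R fun k => ?_
    ext z
    rcases k with _ | k <;>
    simp [telescope_lof, DirectSum.component.of]
  exact congr($this t)

lemma telescope_apply_succ (t : ⨁ k, L k) (k : ℕ) :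
    telescope a t (k + 1) = t (k + 1) - a k (t k) := by
  have : DirectSum.component R ℕ L (k + 1) ∘ₗ telescope a =
      DirectSum.component R ℕ L (k + 1) - a k ∘ₗ DirectSum.component R ℕ L k := by
    refine DirectSum.linearMap_ext R fun m => ?_
    ext z
    by_cases h : m = k
    · subst h
      simp [telescope_lof, DirectSum.component.of]
    · by_cases h' : m = k + 1
      · subst h'
        simp [telescope_lof, DirectSum.component.of]
      · simp [telescope_lof, DirectSum.component.of, h, h']
  exact congr($this t)

lemma telescope_injective : Function.Injective (telescope a) := by
  rw [injective_iff_map_eq_zero]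
  intro t ht
  ext k
  induction k with
  | zero => rw [← telescope_apply_zero a t, ht]
  | succ k ih =>
    have := telescope_apply_succ a t k
    rw [ht, ih] at this
    simpa using this.symm

/-- If the compatible maps `y k : L k → M` are such that an element of `L k` killed by `y k` dies
in the cokernel of the telescope, then this cokernel embeds into `M`. -/
lemma ker_toModule_eq_range_telescope (hy : ∀ k z, y (k + 1) (a k z) = y k z)
    (hker : ∀ k z, y k z = 0 → DirectSum.lof R ℕ L k z ∈ LinearMap.range (telescope a)) :
    LinearMap.ker (DirectSum.toModule R ℕ M y) = LinearMap.range (telescope a) := by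
  have hYT : ∀ t, DirectSum.toModule R ℕ M y (telescope a t) = 0 := fun t => by
    have : DirectSum.toModule R ℕ M y ∘ₗ telescope a = 0 := by
      refine DirectSum.linearMap_ext R fun m => ?_
      ext z
      simp [telescope_lof, hy]
    exact congr($this t)
  have push : ∀ (k : ℕ) (z : L k) (k' : ℕ), k ≤ k' → ∃ z' : L k',
      DirectSum.lof R ℕ L k z - DirectSum.lof R ℕ L k' z' ∈ LinearMap.range (telescope a) := by
    intro k z k' hk
    induction k', hk using Nat.le_induction with
    | base => exact ⟨z, by simp⟩
    | succ k' _ ih =>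
      obtain ⟨z', hz'⟩ := ih
      refine ⟨a k' z', ?_⟩
      convert! Submodule.add_mem _ hz' ⟨DirectSum.lof R ℕ L k' z', telescope_lof a k' z'⟩ using 1
      abel
  have conc : ∀ t : ⨁ k, L k, ∃ (k : ℕ) (z : L k),
      t - DirectSum.lof R ℕ L k z ∈ LinearMap.range (telescope a) := by
    intro t
    induction t using DirectSum.induction_on with
    | zero => exact ⟨0, 0, by simp⟩
    | of k z => exact ⟨k, z, by simp [DirectSum.lof_eq_of]⟩
    | add s t hs ht =>
      obtain ⟨k, z, hz⟩ := hs
      obtain ⟨k', z', hz'⟩ := ht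
      obtain ⟨w, hw⟩ := push k z (max k k') (le_max_left _ _)
      obtain ⟨w', hw'⟩ := push k' z' (max k k') (le_max_right _ _)
      refine ⟨max k k', w + w', ?_⟩
      convert! Submodule.add_mem _ (Submodule.add_mem _ hz hw) (Submodule.add_mem _ hz' hw') using 1
      rw [map_add]
      abel
  refine le_antisymm (fun t ht => ?_) ?_
  · obtain ⟨k, z, hz⟩ := conc t
    have hz0 : y k z = 0 := by
      obtain ⟨s, hs⟩ := hz
      have := hYT s
      rw [hs, map_sub, LinearMap.mem_ker.1 ht, DirectSum.toModule_lof] at this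
      simpa using this
    simpa using Submodule.add_mem _ hz (hker k z hz0)
  · rintro _ ⟨t, rfl⟩
    exact hYT t

end Telescope

/-- The kernel of a presentation of a flat module by countably many generators and relations is
projective. Factoring through finite free modules that trivialize more and more relations writes
`M` as the colimit of a sequence of finite free modules `L k`; its telescope is a projective
presentation with projective kernel, so Schanuel's lemma applies. -/
lemma projective_ker_of_flat_of_countable_relations [Module.Flat R M] (x : (ℕ →₀ R) →ₗ[R] M)
    (hx : Function.Surjective x) (r : ℕ → ℕ →₀ R)
    (hr : LinearMap.ker x = Submodule.span R (Set.range r)) :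
    Module.Projective R (LinearMap.ker x) := by
  have hxr : ∀ i, x (r i) = 0 := fun i =>
    LinearMap.mem_ker.1 (hr ▸ Submodule.subset_span ⟨i, rfl⟩)
  choose l c y hc hy using fun n => exists_factor_of_flat x r hxr n
  choose b hb using fun n => Module.projective_lifting_property x (y n) hx
  have hb' : ∀ n z, x (b n z) = y n z := fun n z => congr($(hb n) z)
  have hspan : ∀ z, x z = 0 → ∃ q, ∀ m, q ≤ m → c m z = 0 := by
    intro z hz
    obtain ⟨d, rfl⟩ := (Finsupp.range_linearCombination (R := R) (v := r)).ge (hr.le hz)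
    obtain ⟨q, hq⟩ := exists_bound_support d
    refine ⟨q, fun m hm => ?_⟩
    have : (c m ∘ₗ Finsupp.linearCombination R r) d ∈ (⊥ : Submodule R _) := by
      refine apply_mem_of_forall_single_mem _ _ d fun i hi => ?_
      simpa using hc m i ((hq i hi).trans_le hm)
    simpa using this
  -- `G n` exceeds `n` and the supports of the range of `b n`; for `m ≥ G n` the map `c m` kills the
  -- elements `b n (c n eⱼ) - eⱼ` of `ker x` with `j < n`.
  have hG : ∀ n, ∃ g, n < g ∧ (∀ z, ∀ i ∈ (b n z).support, i < g) ∧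
      ∀ m, g ≤ m → ∀ j < n, c m (b n (c n (Finsupp.single j 1))) = c m (Finsupp.single j 1) := by
    intro n
    obtain ⟨g₁, hg₁⟩ := exists_bound_support_range (b n)
    have : ∀ j : Fin n, ∃ q, ∀ m, q ≤ m →
        c m (b n (c n (Finsupp.single (j : ℕ) 1)) - Finsupp.single (j : ℕ) 1) = 0 := fun j => by
      refine hspan _ ?_
      rw [map_sub, hb', hy n j j.2, sub_self]
    choose q hq using this
    refine ⟨max (n + 1) (max g₁ (Finset.univ.sup q)), ?_, ?_, ?_⟩
    · exact lt_of_lt_of_le (Nat.lt_succ_self n) (le_max_left _ _)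
    · exact fun z i hi => (hg₁ z i hi).trans_le ((le_max_left _ _).trans (le_max_right _ _))
    · intro m hm j hj
      have h := hq ⟨j, hj⟩ m ((Finset.le_sup (Finset.mem_univ _)).trans
        (((le_max_right _ _).trans (le_max_right _ _)).trans hm))
      rwa [map_sub, sub_eq_zero] at h
  choose G hG₀ hG₁ hG₂ using hG
  let φ : ℕ → ℕ := fun k => G^[k] 0
  have hφ : ∀ k, φ (k + 1) = G (φ k) := fun k => Function.iterate_succ_apply' G k 0
  have hφmono : StrictMono φ := strictMono_nat_of_lt_succ fun k => by rw [hφ]; exact hG₀ _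
  let L : ℕ → Type _ := fun k => Fin (l (φ k)) →₀ R
  let a : ∀ k, L k →ₗ[R] L (k + 1) := fun k => c (φ (k + 1)) ∘ₗ b (φ k)
  have hsupp : ∀ k k', k < k' → ∀ z, ∀ i ∈ (b (φ k) z).support, i < φ k' := fun k k' hk z i hi =>
    (hG₁ _ z i hi).trans_le ((hφ k).symm.le.trans (hφmono.monotone hk))
  -- The maps `y` are compatible with the sequence `a`, whose composite `L k → L k'` is
  -- `c (φ k') ∘ b (φ k)`.
  have hya : ∀ k k', k < k' → ∀ z, y (φ k') (c (φ k') (b (φ k) z)) = y (φ k) z := by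
    intro k k' hk z
    have : (y (φ k') ∘ₗ c (φ k') - x) (b (φ k) z) ∈ (⊥ : Submodule R M) :=
      apply_mem_of_forall_single_mem _ _ _ fun i hi => by
        simpa [sub_eq_zero] using hy (φ k') i (hsupp k k' hk z i hi)
    rw [← hb' (φ k) z]
    simpa [sub_eq_zero] using this
  have hac : ∀ k k', k < k' → ∀ z, a k' (c (φ k') (b (φ k) z)) = c (φ (k' + 1)) (b (φ k) z) := by
    intro k k' hk z
    have : (c (φ (k' + 1)) ∘ₗ b (φ k') ∘ₗ c (φ k') - c (φ (k' + 1))) (b (φ k) z) ∈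
        (⊥ : Submodule R _) :=
      apply_mem_of_forall_single_mem _ _ _ fun i hi => by
        simpa [sub_eq_zero] using hG₂ (φ k') _ (hφ k').ge i (hsupp k k' hk z i hi)
    simpa [sub_eq_zero, a] using this
  have hpush : ∀ k (z : L k), ∀ k', k < k' → DirectSum.lof R ℕ L k z -
      DirectSum.lof R ℕ L k' (c (φ k') (b (φ k) z)) ∈ LinearMap.range (telescope a) := by
    intro k z k' hk
    induction k', hk using Nat.le_induction with
    | base => exact ⟨DirectSum.lof R ℕ L k z, telescope_lof a k z⟩
    | succ k' hk' ih =>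
      convert! Submodule.add_mem _ ih
        ⟨DirectSum.lof R ℕ L k' (c (φ k') (b (φ k) z)), telescope_lof a k' _⟩ using 1
      rw [hac k k' hk' z]
      abel
  let Y : DirectSum ℕ L →ₗ[R] M := DirectSum.toModule R ℕ M (fun k => y (φ k) : ∀ k, L k →ₗ[R] M)
  have hker : LinearMap.ker Y = LinearMap.range (telescope a) := by
    refine ker_toModule_eq_range_telescope a _ (fun k z => hya k (k + 1) k.lt_succ_self z) ?_
    intro k z hz
    obtain ⟨q, hq⟩ := hspan (b (φ k) z) (by rw [hb', hz])
    have := hpush k z (max (k + 1) q) ((Nat.lt_succ_self k).trans_le (le_max_left _ _))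
    rwa [hq _ ((le_max_right _ _).trans (hφmono.id_le _)), map_zero, sub_zero] at this
  have hY : Function.Surjective Y := by
    rw [← LinearMap.range_eq_top, ← top_le_iff, ← LinearMap.range_eq_top.2 hx]
    rintro _ ⟨z, rfl⟩
    refine apply_mem_of_forall_single_mem _ _ _ fun i _ => ?_
    rw [← hy (φ (i + 1)) i (i.lt_succ_self.trans_le (hφmono.id_le _))]
    exact ⟨DirectSum.lof R ℕ L (i + 1) (c (φ (i + 1)) (Finsupp.single i 1)),
      DirectSum.toModule_lof R (M := L) (i + 1) _⟩
  have hL : Module.Projective R (DirectSum ℕ L) :=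
    inferInstanceAs (Module.Projective R (Π₀ k, L k))
  have : Module.Projective R (LinearMap.ker Y) := by
    rw [hker]
    exact Module.Projective.of_equiv' (LinearEquiv.ofInjective _ (telescope_injective a))
  exact projective_ker_of_projective_ker (P' := DirectSum ℕ L) x hx Y hY

/-- A flat module which is a quotient of a countably generated projective module by a countably
generated submodule has projective dimension at most one. A splitting of a countable free cover of
`A` turns the presentation into one by countably many generators and relations. -/
theorem projective_ker_of_flat_of_countable [Module.Flat R M] {A P : Type*} [AddCommGroup A]
    [Module R A] [Module.Projective R A] (hA : IsCountablyGenerated R A) (q : A →ₗ[R] M)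
    (hq : Function.Surjective q) (hB : IsCountablyGenerated R (LinearMap.ker q))
    [AddCommGroup P] [Module R P] [Module.Projective R P] (p : P →ₗ[R] M)
    (hp : Function.Surjective p) : Module.Projective R (LinearMap.ker p) := by
  obtain ⟨g, hg⟩ := hA.exists_nat
  obtain ⟨b, hb⟩ := exists_nat_span_eq _ hB
  let π : (ℕ →₀ R) →ₗ[R] A := Finsupp.linearCombination R g
  have hπ : Function.Surjective π := by
    rw [← LinearMap.range_eq_top, Finsupp.range_linearCombination, hg]
  obtain ⟨σ, hσ⟩ := Module.projective_lifting_property π LinearMap.id hπ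
  have hσ' : ∀ z, π (σ z) = z := fun z => congr($hσ z)
  let r' : ℕ ⊕ ℕ → (ℕ →₀ R) :=
    Sum.elim (fun i => Finsupp.single i 1 - σ (π (Finsupp.single i 1))) fun i => σ (b i)
  let r : ℕ → (ℕ →₀ R) := r' ∘ Equiv.natSumNatEquivNat.symm
  have hr : Set.range r = Set.range r' := EquivLike.range_comp _ _
  -- `ker (q ∘ π)` is generated by `ker π`, which is the range of `1 - σ ∘ π`, and by lifts of
  -- generators of `ker q`.
  have hker : LinearMap.ker (q ∘ₗ π) = Submodule.span R (Set.range r) := by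
    rw [hr]
    refine le_antisymm (fun z hz => ?_) (Submodule.span_le.2 ?_)
    · have h1 : (LinearMap.id - σ ∘ₗ π : (ℕ →₀ R) →ₗ[R] (ℕ →₀ R)) z ∈
          Submodule.span R (Set.range r') :=
        apply_mem_of_forall_single_mem _ _ _ fun i _ => Submodule.subset_span ⟨Sum.inl i, rfl⟩
      have h2 : σ (π z) ∈ Submodule.span R (Set.range r') := by
        have h3 : π z ∈ Submodule.span R (Set.range b) := hb.ge hz
        have h4 := Submodule.mem_map_of_mem (f := σ) h3
        rw [Submodule.map_span] at h4
        refine Submodule.span_mono ?_ h4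
        rintro _ ⟨_, ⟨i, rfl⟩, rfl⟩
        exact ⟨Sum.inr i, rfl⟩
      simpa using Submodule.add_mem _ h1 h2
    · rintro _ ⟨i | i, rfl⟩
      · simp [r', hσ']
      · have : b i ∈ LinearMap.ker q := hb ▸ Submodule.subset_span ⟨i, rfl⟩
        simpa [r', hσ'] using this
  have := projective_ker_of_flat_of_countable_relations (q ∘ₗ π) (hq.comp hπ) r hker
  exact projective_ker_of_projective_ker p hp (q ∘ₗ π) (hq.comp hπ)

end Algebra

/-! ### Quasi-coherent subsheaves of finite type -/

/-- Over a smaller affine open, the sections of a quasi-coherent sheaf are generated by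
restrictions. -/
lemma span_range_res (M : X.Modules) (hM : M.IsQuasicoherent) {V U : X.Opens}
    (hV : IsAffineOpen V) (hU : IsAffineOpen U) (h : V ≤ U) :
    Submodule.span Γ(X, V) (Set.range (res M h)) = ⊤ := by
  rw [eq_top_iff]
  rintro s -
  choose f hf hxf using fun x : V => hU.exists_basicOpen_le x (h x.2)
  let r : V → Γ(X, V) := fun x => X.presheaf.map (homOfLE h).op (f x)
  have hr : ∀ x, X.basicOpen (r x) = X.basicOpen (f x) := fun x => by
    rw [X.basicOpen_res, inf_eq_right.2 (hf x)]
  refine Submodule.mem_of_span_eq_top_of_smul_pow_mem _ (Set.range r) ?_ s ?_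
  · rw [← hV.self_le_iSup_basicOpen_iff]
    intro x hx
    exact TopologicalSpace.Opens.mem_iSup.2 ⟨⟨r ⟨x, hx⟩, ⟨x, hx⟩, rfl⟩, by
      rw [hr]; exact hxf ⟨x, hx⟩⟩
  · rintro ⟨_, x, rfl⟩
    obtain ⟨n, t, ht⟩ := (localizesAt_basicOpen hU M hM (f x)).1 (res M (hf x) s)
    have key : LocalizesAt M (hf x) (r x) := by
      have := (localizesAt_congr M (X.basicOpen_le (r x)) (hf x) rfl (hr x).symm (r x)).2
        (localizesAt_basicOpen hV M hM (r x))
      rwa [show X.presheaf.map (homOfLE (le_refl V)).op (r x) = r x from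
        congr($(X.presheaf.map_id _) (r x))] at this
    obtain ⟨m, hm⟩ := key.2 ((r x) ^ n • s - res M h t) (by
      change res M (hf x) _ = 0
      rw [map_sub, res_smul, res_res, sub_eq_zero, map_pow]
      refine Eq.trans ?_ ht.symm
      congr 2
      exact congr($(X.presheaf.map_comp (homOfLE h).op (homOfLE (hf x)).op) (f x)).symm)
    refine ⟨m + n, ?_⟩
    rw [smul_sub, sub_eq_zero, smul_smul, ← pow_add] at hm
    rw [hm]
    exact Submodule.smul_mem _ _ (Submodule.subset_span ⟨t, rfl⟩)

/-- The structure sheaf, as a sheaf of modules over itself. -/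
noncomputable def structureSheaf (X : Scheme.{u}) : X.Modules := SheafOfModules.unit X.ringCatSheaf

lemma isQuasicoherent_structureSheaf (X : Scheme.{u}) : (structureSheaf X).IsQuasicoherent := by
  refine (isQuasicoherent_iff_localizesAt _).2 fun U hU f => ?_
  have := hU.isLocalization_basicOpen f
  refine ⟨fun (s : Γ(X, X.basicOpen f)) => ?_, fun (t : Γ(X, U)) ht => ?_⟩
  · obtain ⟨n, t, ht⟩ := IsLocalization.Away.surj f s
    exact ⟨n, t, ht.symm.trans (mul_comm _ _)⟩
  · obtain ⟨⟨_, n, rfl⟩, hn⟩ := (IsLocalization.map_eq_zero_iff (Submonoid.powers f)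
      Γ(X, X.basicOpen f) t).1 ht
    exact ⟨n, hn⟩

/-- A global section `t` of `M` defines the map `r ↦ r • t` from the structure sheaf to `M`. -/
lemma exists_hom_of_section (M : X.Modules) (t : Γ(M, ⊤)) : ∃ φ : structureSheaf X ⟶ M,
    ∀ (W : X.Opens) (r : Γ(X, W)), appₗ φ W r = r • res M le_top t := by
  let σ : SheafOfModules.sections M := PresheafOfModules.sectionsMk (M := M.val)
    (fun W => res M (V := W.unop) le_top t) fun V W f => res_res M _ _ t
  let φ : structureSheaf X ⟶ M := (SheafOfModules.unitHomEquiv M).symm σ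
  refine ⟨φ, fun W r => ?_⟩
  have h1 : appₗ φ W (1 : Γ(X, W)) = res M le_top t := by
    have := (SheafOfModules.unitHomEquiv M).apply_symm_apply σ
    exact congr(($this).val (Opposite.op W))
  have h2 := (appₗ φ W).map_smul r (1 : Γ(X, W))
  rw [h1] at h2
  refine Eq.trans ?_ h2
  congr 1
  exact (mul_one r).symm

/-- The quotient of `M` by the submodule generated by a family of global sections. -/
lemma exists_quotient_by_sections (M : X.Modules) (hM : M.IsQuasicoherent) {κ : Type u}
    (t : κ → Γ(M, ⊤)) : ∃ (C : X.Modules) (g : M ⟶ C), C.IsQuasicoherent ∧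
      ∀ W : X.Opens, IsAffineOpen W → ∀ s : Γ(M, W), appₗ g W s = 0 ↔
        s ∈ Submodule.span Γ(X, W) (Set.range fun i => res M le_top (t i)) := by
  choose φ hφ using fun i => exists_hom_of_section M (t i)
  let f : (∐ fun _ : κ => structureSheaf X) ⟶ M := Sigma.desc φ
  have hP : (∐ fun _ : κ => structureSheaf X).IsQuasicoherent :=
    isQuasicoherent_coprod _ fun _ => isQuasicoherent_structureSheaf X
  refine ⟨cokernel f, cokernel.π f, isQuasicoherent_cokernel hP hM f _ (cokernel.condition f)
    (cokernelIsCokernel f), fun W hW s => ?_⟩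
  have hι : ∀ i (r : Γ(X, W)), appₗ f W (appₗ (Sigma.ι (fun _ : κ => structureSheaf X) i) W r) =
      r • res M le_top (t i) := fun i r =>
    congr(appₗ $(Sigma.ι_desc φ i) W r).trans (hφ i W r)
  rw [(cokernel_sections hP hM f _ (cokernel.condition f) (cokernelIsCokernel f) hW).2 s]
  constructor
  · rintro ⟨p, rfl⟩
    have := coprod_sections _ (fun _ : κ => isQuasicoherent_structureSheaf X) hW p
    refine AddSubgroup.closure_induction (p := fun p _ => appₗ f W p ∈ _) ?_ ?_ ?_ ?_ this
    · rintro _ ⟨i, r, rfl⟩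
      rw [hι i r]
      exact Submodule.smul_mem _ _ (Submodule.subset_span ⟨i, rfl⟩)
    · rw [map_zero]; exact Submodule.zero_mem _
    · intro x y _ _ hx hy
      rw [map_add]; exact Submodule.add_mem _ hx hy
    · intro x _ hx
      rw [map_neg]; exact Submodule.neg_mem _ hx
  · intro hs
    refine (Submodule.span_le (p := LinearMap.range (appₗ f W))).2 ?_ hs
    rintro _ ⟨i, rfl⟩
    exact ⟨_, (hι i 1).trans (one_smul _ _)⟩

/-- Transport of a generation statement along an equality of opens. -/
lemma span_res_congr (G : X.Modules) {U W W' : X.Opens} (hWU : W ≤ U) (hWU' : W' ≤ U)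
    (h : W = W') {V : X.Opens} (hV : W ≤ V) (hV' : W' ≤ V) {κ : Type*} (t : κ → Γ(G, U))
    (s : Γ(G, V)) :
    res G hV s ∈ Submodule.span Γ(X, W) (Set.range fun i => res G hWU (t i)) ↔
      res G hV' s ∈ Submodule.span Γ(X, W') (Set.range fun i => res G hWU' (t i)) := by
  subst h; rfl

lemma mem_span_range_of_semilinear {R S M N : Type*} [CommRing R] [CommRing S] [AddCommGroup M]
    [AddCommGroup N] [Module R M] [Module S N] (e : R → S) (φ : M → N) (h0 : φ 0 = 0)
    (hadd : ∀ x y, φ (x + y) = φ x + φ y) (hsmul : ∀ (r : R) x, φ (r • x) = e r • φ x) {κ : Type*}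
    (t : κ → M) {x : M} (hx : x ∈ Submodule.span R (Set.range t)) :
    φ x ∈ Submodule.span S (Set.range fun i => φ (t i)) := by
  induction hx using Submodule.span_induction with
  | mem x hx => obtain ⟨i, rfl⟩ := hx; exact Submodule.subset_span ⟨i, rfl⟩
  | zero => rw [h0]; exact Submodule.zero_mem _
  | add x y _ _ hx hy => rw [hadd]; exact Submodule.add_mem _ hx hy
  | smul r x _ hx => rw [hsmul]; exact Submodule.smul_mem _ _ hx

/-- The quasi-coherent subsheaf of sections of `G` whose restriction to `U` is generated by the
`t i`. It is the kernel of the map from `G` to the direct image of the quotient of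
`G.restrict U.ι` by the `t i`; the direct image is quasi-coherent since `U` meets affine opens in
affine opens. -/
lemma exists_subsheaf (G : X.Modules) (hG : G.IsQuasicoherent) (U : X.Opens)
    (hU : ∀ V : X.Opens, IsAffineOpen V → IsAffineOpen (V ⊓ U)) {κ : Type u} (t : κ → Γ(G, U)) :
    ∃ (G' : X.Modules) (i : G' ⟶ G), G'.IsQuasicoherent ∧
      (∀ V, Function.Injective (appₗ i V)) ∧
      ∀ V : X.Opens, IsAffineOpen V → ∀ s : Γ(G, V), s ∈ LinearMap.range (appₗ i V) ↔
        res G inf_le_left s ∈ Submodule.span Γ(X, V ⊓ U)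
          (Set.range fun i => res G inf_le_right (t i)) := by
  have hY : ∀ V : X.Opens, U.ι ''ᵁ (U.ι ⁻¹ᵁ V) = V ⊓ U := fun V => by
    rw [Scheme.Hom.image_preimage_eq_opensRange_inf, Scheme.Opens.opensRange_ι, inf_comm]
  have hpre : ∀ V : X.Opens, IsAffineOpen V → IsAffineOpen (U.ι ⁻¹ᵁ V) := fun V hV => by
    rw [← U.ι.isAffineOpen_iff_of_isOpenImmersion, hY]
    exact hU V hV
  have htop : U.ι ''ᵁ ⊤ ≤ U := U.ι_image_le ⊤
  have hM : (G.restrict U.ι).IsQuasicoherent := inferInstance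
  obtain ⟨C, g, hC, hg⟩ := exists_quotient_by_sections (G.restrict U.ι) hM
    (fun i => (G.restrictAppIso U.ι ⊤).inv (res G htop (t i)))
  let f : G ⟶ (pushforward U.ι).obj C :=
    (restrictAdjunction U.ι).unit.app G ≫ (pushforward U.ι).map g
  have hl := kernelIsKernel f
  refine ⟨kernel f, kernel.ι f, isQuasicoherent_kernel hG
    (isQuasicoherent_pushforward U.ι hpre C hC) _ f (kernel.condition f) hl,
    fun V => (kernel_sections _ f (kernel.condition f) hl V).1, fun V hV s => ?_⟩
  have hle : U.ι ''ᵁ (U.ι ⁻¹ᵁ V) ≤ V := U.ι.image_preimage_le V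
  have h1 : appₗ f V s = 0 ↔ appₗ g (U.ι ⁻¹ᵁ V)
    ((G.restrictAppIso U.ι (U.ι ⁻¹ᵁ V)).inv (res G hle s)) = 0 := Iff.rfl
  have h2 := ((kernel_sections _ f (kernel.condition f) hl V).2 s).symm
  refine Iff.trans h2 (h1.trans ((hg _ (hpre V hV) _).trans ?_))
  rw [← span_res_congr G (U.ι_image_le _) inf_le_right (hY V) hle inf_le_left t s]
  have h3 : ∀ i, res G (U.ι_image_le (U.ι ⁻¹ᵁ V)) (t i) =
      res G (U.ι.image_mono le_top) (res G htop (t i)) := fun i => (res_res _ _ _ _).symm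
  simp only [h3]
  constructor
  · exact mem_span_range_of_semilinear (fun r => (U.ι.appIso _).inv r)
      (fun x => (G.restrictAppIso U.ι (U.ι ⁻¹ᵁ V)).hom x) (map_zero _) (map_add _)
      (fun r x => smul_restrictAppIso_hom_apply _ _ _ _ _) _
  · exact mem_span_range_of_semilinear (fun r => (U.ι.appIso _).hom r)
      (fun x => (G.restrictAppIso U.ι (U.ι ⁻¹ᵁ V)).inv x) (map_zero _) (map_add _)
      (fun r x => smul_restrictAppIso_inv_apply _ _ _ _ _) _

lemma exists_finite_mem_span {R M κ : Type*} [CommRing R] [AddCommGroup M] [Module R M]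
    (t : κ → M) (ht : Submodule.span R (Set.range t) = ⊤) (x : M) :
    ∃ s : Set κ, s.Finite ∧ x ∈ Submodule.span R (t '' s) := by
  have hx : x ∈ Submodule.span R (Set.range t) := ht ▸ Submodule.mem_top
  obtain ⟨T, hT, hxT⟩ := Submodule.mem_span_finite_of_mem_span hx
  rw [← Set.image_univ] at hT
  obtain ⟨s, -, hs, hs'⟩ := Set.exists_subset_image_finite_and
    (p := fun A => x ∈ Submodule.span R A).1 ⟨T, hT, T.finite_toSet, hxT⟩
  exact ⟨s, hs, hs'⟩

lemma exists_finite_span_eq_top {R M κ : Type*} [CommRing R] [AddCommGroup M] [Module R M]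
    [Module.Finite R M] (t : κ → M) (ht : Submodule.span R (Set.range t) = ⊤) :
    ∃ s : Set κ, s.Finite ∧ Submodule.span R (t '' s) = ⊤ := by
  obtain ⟨n, g, hg⟩ := Module.Finite.exists_fin (R := R) (M := M)
  choose s hs hgs using fun i => exists_finite_mem_span t ht (g i)
  refine ⟨⋃ i, s i, Set.finite_iUnion hs, ?_⟩
  rw [eq_top_iff, ← hg, Submodule.span_le]
  rintro _ ⟨i, rfl⟩
  exact Submodule.span_mono (Set.image_mono (Set.subset_iUnion s i)) (hgs i)

lemma finite_sections_of_le (M : X.Modules) (hM : M.IsQuasicoherent) {V U : X.Opens}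
    (hV : IsAffineOpen V) (hU : IsAffineOpen U) (h : V ≤ U) [Module.Finite Γ(X, U) Γ(M, U)] :
    Module.Finite Γ(X, V) Γ(M, V) := by
  obtain ⟨n, g, hg⟩ := Module.Finite.exists_fin (R := Γ(X, U)) (M := Γ(M, U))
  refine ⟨⟨(Set.finite_range fun i => res M h (g i)).toFinset, ?_⟩⟩
  rw [Set.Finite.coe_toFinset, ← span_range_res M hM hV hU h]
  refine le_antisymm (Submodule.span_mono ?_) (Submodule.span_le.2 ?_)
  · rintro _ ⟨i, rfl⟩; exact ⟨_, rfl⟩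
  · rintro _ ⟨x, rfl⟩
    refine mem_span_range_of_semilinear (fun r => X.presheaf.map (homOfLE h).op r) (res M h)
      (map_zero _) (map_add _) (res_smul M h) g ?_
    rw [hg]
    exact Submodule.mem_top

/-- A section `s` over an affine open lies in the image of a quasi-coherent sheaf with finitely
generated sections over prescribed affine opens. When passing to the next open `U a`, the new
subsheaf keeps the sections over the previous opens and the section `s`, provided that the
finitely many generators chosen over `U a` suffice after restriction to the intersections with
these opens. -/
lemma exists_finite_type_hom [IsAffineHom (pullback.diagonal (terminal.from X))]
    (F : X.Modules) (hF : F.IsQuasicoherent) {ι : Type*} (U : ι → X.affineOpens) (S : Finset ι)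
    {V : X.Opens} (hV : IsAffineOpen V) (s : Γ(F, V)) :
    ∃ (G : X.Modules) (i : G ⟶ F), G.IsQuasicoherent ∧
      (∀ a ∈ S, Module.Finite Γ(X, U a) Γ(G, U a)) ∧
      s ∈ LinearMap.range (appₗ i V) := by
  classical
  induction S using Finset.induction_on with
  | empty => exact ⟨F, 𝟙 F, hF, by simp, s, rfl⟩
  | insert a S _ ih =>
    obtain ⟨G, i, hG, hfin, g, rfl⟩ := ih
    have hinf : ∀ V : X.Opens, IsAffineOpen V → IsAffineOpen (V ⊓ U a) := fun V hV => hV.inf (U a).2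
    have hspan : ∀ V : X.Opens, IsAffineOpen V → Submodule.span Γ(X, V ⊓ U a)
        (Set.range (res G (inf_le_right : V ⊓ U a ≤ U a))) = ⊤ := fun V hV =>
      span_range_res G hG (hinf V hV) (U a).2 inf_le_right
    have h1 : ∀ b : S, ∃ T : Set Γ(G, U a), T.Finite ∧ Submodule.span Γ(X, (U b).1 ⊓ U a)
        (res G (inf_le_right : (U b).1 ⊓ U a ≤ U a) '' T) = ⊤ := fun b => by
      have := hfin b b.2
      have := finite_sections_of_le G hG (hinf _ (U b).2) (U b).2 inf_le_left
      have h2 := hspan (U b).1 (U b).2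
      exact exists_finite_span_eq_top (res G (inf_le_right : (U b).1 ⊓ U a ≤ U a)) h2
    choose T hT hT' using h1
    obtain ⟨T₀, hT₀, hT₀'⟩ := exists_finite_mem_span _ (hspan V hV) (res G inf_le_left g)
    let T₁ : Set Γ(G, U a) := T₀ ∪ ⋃ b, T b
    have hT₁ : T₁.Finite := hT₀.union (Set.finite_iUnion hT)
    obtain ⟨G', j, hG', hj, hjr⟩ := exists_subsheaf G hG (U a) hinf (fun t : T₁ => t.1)
    have himg : ∀ V : X.Opens, (Set.range fun t : T₁ => res G (inf_le_right : V ⊓ U a ≤ U a) t.1) =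
        res G inf_le_right '' T₁ := fun V => by rw [Set.image_eq_range]
    refine ⟨G', j ≫ i, hG', ?_, ?_⟩
    · intro b hb
      rcases Finset.mem_insert.1 hb with rfl | hb
      · have hr : LinearMap.range (appₗ j (U b)) = Submodule.span _ T₁ := by
          ext x
          rw [hjr _ (U b).2 x, span_res_congr G (inf_le_right : (U b).1 ⊓ U b ≤ U b) le_rfl
            (inf_idem _) inf_le_left le_rfl]
          simp only [res_self, Subtype.range_coe]
        refine ⟨Submodule.fg_of_fg_map_injective (appₗ j (U b)) (hj _) ?_⟩
        rw [Submodule.map_top, hr]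
        exact Submodule.fg_span hT₁
      · have := hfin b hb
        have hsurj : Function.Surjective (appₗ j (U b)) := fun x => by
          refine (hjr _ (U b).2 x).2 ?_
          rw [himg]
          have h2 : res G inf_le_left x ∈ Submodule.span Γ(X, (U b).1 ⊓ U a)
            (res G inf_le_right '' T ⟨b, hb⟩) := (hT' ⟨b, hb⟩).ge Submodule.mem_top
          exact Submodule.span_mono (Set.image_mono
            ((Set.subset_iUnion T ⟨b, hb⟩).trans Set.subset_union_right)) h2
        exact Module.Finite.equiv (LinearEquiv.ofBijective (appₗ j (U b)) ⟨hj _, hsurj⟩).symm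
    · obtain ⟨g', rfl⟩ := (hjr V hV g).2 (by
        rw [himg]
        exact Submodule.span_mono (Set.image_mono Set.subset_union_left) hT₀')
      exact ⟨g', rfl⟩

lemma exists_finite_affine_cover (X : Scheme.{u}) [CompactSpace X] :
    ∃ (n : ℕ) (U : Fin n → X.affineOpens), (⨆ i, U i : X.Opens) = ⊤ := by
  obtain ⟨s, hs, e⟩ := (isCompact_iff_finite_and_eq_biUnion_affineOpens
    (X := X) (U := ⊤)).1 isCompact_univ
  have := hs.to_subtype
  obtain ⟨n, ⟨f⟩⟩ := Finite.exists_equiv_fin s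
  refine ⟨n, fun i => (f.symm i).1, ?_⟩
  rw [e, f.symm.iSup_comp (g := fun i : s => (i.1 : X.Opens)), iSup_subtype]

lemma IsCountablyGenerated.of_finite (R M : Type*) [CommRing R] [AddCommGroup M] [Module R M]
    [h : Module.Finite R M] : IsCountablyGenerated R M := by
  obtain ⟨s, hs⟩ := h.fg_top
  exact ⟨s, s.countable_toSet, hs⟩

/-! ### From the resolution property to enough vector bundles -/

/-- The direct sum is indexed by all sections of `F` over the members of a finite affine cover;
each of them is hit by a vector bundle of finite type. -/
theorem hasEnough_of_hasResolutionProperty [CompactSpace X]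
    [IsAffineHom (pullback.diagonal (terminal.from X))] (hX : HasResolutionProperty X) :
    HasEnoughLocallyCountablyGeneratedVectorBundles X := by
  intro F hF
  obtain ⟨n, U, hU⟩ := exists_finite_affine_cover X
  have key : ∀ j : (Σ i, Γ(F, U i)), ∃ (P : X.Modules) (φ : P ⟶ F), IsVectorBundle P ∧
      IsLocallyFinitelyGenerated P ∧ j.2 ∈ LinearMap.range (appₗ φ (U j.1)) := by
    rintro ⟨i, s⟩
    obtain ⟨G, f, hG, hfin, g, hg⟩ := exists_finite_type_hom F hF U Finset.univ (U i).2 s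
    obtain ⟨P, π, hP, hPfin, _⟩ := hX G hG fun V hV =>
      finite_of_cover G hG U hU (fun i => hfin i (Finset.mem_univ i)) ⟨V, hV⟩
    obtain ⟨p, rfl⟩ := surjective_of_epi hP.1 hG π (U i).2 g
    exact ⟨P, π ≫ f, hP, hPfin, p, hg⟩
  choose P φ hP hfin hφ using key
  let J : Type u := Σ i : ULift.{u} (Fin n), Γ(F, U i.down)
  let e : J → (Σ i, Γ(F, U i)) := fun j => ⟨j.1.down, j.2⟩
  have hcop := isQuasicoherent_coprod (fun j : J => P (e j)) fun j => (hP _).1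
  refine ⟨J, fun j => P (e j), Sigma.desc fun j => φ (e j), fun j => ⟨hP _, fun V hV => ?_⟩, ?_⟩
  · have := hfin (e j) V hV
    exact .of_finite _ _
  · refine epi_of_cover hcop hF _ U hU fun i s => ?_
    obtain ⟨p, hp⟩ := hφ ⟨i, s⟩
    refine ⟨appₗ (Sigma.ι (fun j : J => P (e j)) ⟨⟨i⟩, s⟩) (U i) p, Eq.trans ?_ hp⟩
    exact congr(appₗ $(Sigma.ι_desc (fun j : J => φ (e j)) ⟨⟨i⟩, s⟩) (U i) p)

/-! ### Cokernels of maps between partial coproducts -/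

section SubCoproduct

variable {C : Type w} [Category.{w'} C] [HasCoproducts.{u} C] {J : Type u}
  (P : J → C)

/-- The coproduct of the objects `P j` with `j ∈ S`. -/
noncomputable abbrev subCoprod (S : Set J) : C := ∐ fun j : S => P j

/-- The inclusion of a partial coproduct into the full one. -/
noncomputable def subCoprodι (S : Set J) : subCoprod P S ⟶ ∐ P :=
  Sigma.desc fun j : S => Sigma.ι P j

lemma ι_subCoprodι (S : Set J) (j : S) :
    Sigma.ι (fun j : S => P j) j ≫ subCoprodι P S = Sigma.ι P j :=
  Sigma.ι_desc _ _

lemma ι_subCoprodι_assoc (S : Set J) (j : S) {K : C} (h : ∐ P ⟶ K) :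
    Sigma.ι (fun j : S => P j) j ≫ subCoprodι P S ≫ h = Sigma.ι P j ≫ h := by
  rw [← Category.assoc, ι_subCoprodι]

variable [HasZeroMorphisms C]

open Classical in
/-- The projection from the full coproduct to a partial one, which is zero on the summands outside
`S`. -/
noncomputable def subCoprodρ (S : Set J) : ∐ P ⟶ subCoprod P S :=
  Sigma.desc fun j => if h : j ∈ S then Sigma.ι (fun j : S => P j) ⟨j, h⟩ else 0

lemma ι_subCoprodρ (S : Set J) (j : J) (h : j ∈ S) :
    Sigma.ι P j ≫ subCoprodρ P S = Sigma.ι (fun j : S => P j) ⟨j, h⟩ := by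
  rw [subCoprodρ, Sigma.ι_desc, dif_pos h]

lemma ι_subCoprodρ_subCoprodι (S : Set J) (j : J) (h : j ∈ S) :
    Sigma.ι P j ≫ subCoprodρ P S ≫ subCoprodι P S = Sigma.ι P j := by
  rw [← Category.assoc, ι_subCoprodρ P S j h]
  exact ι_subCoprodι P S ⟨j, h⟩

lemma subCoprodι_subCoprodρ_of_subset {S T : Set J} (h : S ⊆ T) :
    subCoprodι P S ≫ subCoprodρ P T ≫ subCoprodι P T = subCoprodι P S := by
  refine Sigma.hom_ext _ _ fun j => ?_
  rw [ι_subCoprodι_assoc, ι_subCoprodρ_subCoprodι P T j (h j.2), ι_subCoprodι]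

lemma subCoprodι_subCoprodρ_of_subset_assoc {S T : Set J} (h : S ⊆ T) {K : C} (k : ∐ P ⟶ K) :
    subCoprodι P S ≫ subCoprodρ P T ≫ subCoprodι P T ≫ k = subCoprodι P S ≫ k := by
  have h' := subCoprodι_subCoprodρ_of_subset P h =≫ k
  simpa only [Category.assoc] using h'

lemma subCoprodι_subCoprodρ (S : Set J) :
    subCoprodι P S ≫ subCoprodρ P S = 𝟙 _ := by
  refine Sigma.hom_ext _ _ fun j => ?_
  rw [ι_subCoprodι_assoc, ι_subCoprodρ P S j j.2, Category.comp_id]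

lemma subCoprodι_subCoprodρ_assoc (S : Set J) {K : C} (k : subCoprod P S ⟶ K) :
    subCoprodι P S ≫ subCoprodρ P S ≫ k = k := by
  rw [← Category.assoc, subCoprodι_subCoprodρ, Category.id_comp]

instance (S : Set J) : Mono (subCoprodι P S) := mono_of_mono_fac (subCoprodι_subCoprodρ P S)

end SubCoproduct

section Cokernels

variable {C : Type w} [Category.{w'} C] [HasZeroMorphisms C] [HasCoproducts.{u} C]
  {I J : Type u} {Q : I → C} {P : J → C} (φ : ∐ Q ⟶ ∐ P)

/-- The map `φ` sends `∐_{i ∈ z.1} Q i` into `∐_{j ∈ z.2} P j`. As the latter is a direct summand,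
this says that the corresponding idempotent of `∐ P` does not change `φ` on the `Q i`. -/
def Restricts (z : Set I × Set J) : Prop :=
  ∀ i ∈ z.1, Sigma.ι Q i ≫ φ ≫ subCoprodρ P z.2 ≫ subCoprodι P z.2 = Sigma.ι Q i ≫ φ

variable {φ}

lemma Restricts.comp {z : Set I × Set J} (h : Restricts φ z) :
    subCoprodι Q z.1 ≫ φ ≫ subCoprodρ P z.2 ≫ subCoprodι P z.2 = subCoprodι Q z.1 ≫ φ := by
  refine Sigma.hom_ext _ _ fun i => ?_
  rw [ι_subCoprodι_assoc, ι_subCoprodι_assoc, h i i.2]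

variable (φ)

/-- The map between partial coproducts induced by `φ`. It is only compatible with `φ` if `φ`
restricts to them. -/
noncomputable def subMap (z : Set I × Set J) : subCoprod Q z.1 ⟶ subCoprod P z.2 :=
  subCoprodι Q z.1 ≫ φ ≫ subCoprodρ P z.2

variable {φ}

lemma subMap_subCoprodι {z : Set I × Set J} (h : Restricts φ z) :
    subMap φ z ≫ subCoprodι P z.2 = subCoprodι Q z.1 ≫ φ := by
  simp only [subMap, Category.assoc, h.comp]

lemma subMap_subCoprodι_assoc {z : Set I × Set J} (h : Restricts φ z) {K : C} (k : ∐ P ⟶ K) :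
    subMap φ z ≫ subCoprodι P z.2 ≫ k = subCoprodι Q z.1 ≫ φ ≫ k := by
  rw [← Category.assoc, subMap_subCoprodι h, Category.assoc]

lemma subMap_comm {z w : Set I × Set J} (hz : Restricts φ z) (hw : Restricts φ w) (hzw : z ≤ w) :
    subMap φ z ≫ subCoprodι P z.2 ≫ subCoprodρ P w.2 =
      (subCoprodι Q z.1 ≫ subCoprodρ Q w.1) ≫ subMap φ w := by
  rw [subMap_subCoprodι_assoc hz, ← cancel_mono (subCoprodι P w.2)]
  simp only [Category.assoc, subMap_subCoprodι hw]
  rw [subCoprodι_subCoprodρ_of_subset_assoc Q hzw.1]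
  rw [← subCoprodι_subCoprodρ_of_subset_assoc Q hzw.1, hw.comp,
    subCoprodι_subCoprodρ_of_subset_assoc Q hzw.1]

variable [HasCokernels C] {F : C} (q : ∐ P ⟶ F)

/-- The map between cokernels of partial maps induced by an inclusion of pairs of index sets. -/
noncomputable def subCokerMap {z w : Set I × Set J} (hz : Restricts φ z) (hw : Restricts φ w)
    (hzw : z ≤ w) : cokernel (subMap φ z) ⟶ cokernel (subMap φ w) :=
  cokernel.map _ _ (subCoprodι Q z.1 ≫ subCoprodρ Q w.1) (subCoprodι P z.2 ≫ subCoprodρ P w.2)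
    (subMap_comm hz hw hzw)

lemma π_subCokerMap {z w : Set I × Set J} (hz : Restricts φ z) (hw : Restricts φ w)
    (hzw : z ≤ w) : cokernel.π (subMap φ z) ≫ subCokerMap hz hw hzw =
      subCoprodι P z.2 ≫ subCoprodρ P w.2 ≫ cokernel.π (subMap φ w) := by
  simp [subCokerMap]

lemma π_subCokerMap_assoc {z w : Set I × Set J} (hz : Restricts φ z) (hw : Restricts φ w)
    (hzw : z ≤ w) {K : C} (k : cokernel (subMap φ w) ⟶ K) :
    cokernel.π (subMap φ z) ≫ subCokerMap hz hw hzw ≫ k =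
      subCoprodι P z.2 ≫ subCoprodρ P w.2 ≫ cokernel.π (subMap φ w) ≫ k := by
  rw [← Category.assoc, π_subCokerMap]
  simp only [Category.assoc]

/-- The map from the cokernel of a partial map to a quotient `F` of `∐ P` by the image of `φ`. -/
noncomputable def subCokerDesc (hφq : φ ≫ q = 0) {z : Set I × Set J} (hz : Restricts φ z) :
    cokernel (subMap φ z) ⟶ F :=
  cokernel.desc _ (subCoprodι P z.2 ≫ q) (by
    rw [subMap_subCoprodι_assoc hz, hφq, comp_zero])

lemma π_subCokerDesc (hφq : φ ≫ q = 0) {z : Set I × Set J} (hz : Restricts φ z) :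
    cokernel.π (subMap φ z) ≫ subCokerDesc q hφq hz = subCoprodι P z.2 ≫ q :=
  cokernel.π_desc _ _ _

lemma π_subCokerDesc_assoc (hφq : φ ≫ q = 0) {z : Set I × Set J} (hz : Restricts φ z) {K : C}
    (k : F ⟶ K) : cokernel.π (subMap φ z) ≫ subCokerDesc q hφq hz ≫ k =
      subCoprodι P z.2 ≫ q ≫ k := by
  rw [← Category.assoc, π_subCokerDesc, Category.assoc]

variable (Z : Set (Set I × Set J)) (hZ : ∀ z ∈ Z, Restricts φ z)

/-- The cokernels of partial maps, as a diagram indexed by a set of pairs of index sets. -/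
noncomputable def subCokerFunctor : Z ⥤ C where
  obj z := cokernel (subMap φ z.1)
  map {z w} h := subCokerMap (hZ z z.2) (hZ w w.2) (leOfHom h)
  map_id z := by
    rw [← cancel_epi (cokernel.π _), π_subCokerMap, subCoprodι_subCoprodρ_assoc, Category.comp_id]
  map_comp {z w v} f g := by
    rw [← cancel_epi (cokernel.π _), π_subCokerMap, π_subCokerMap_assoc, π_subCokerMap,
      subCoprodι_subCoprodρ_of_subset_assoc P (leOfHom f).2]

/-- The cocone with vertex `F` over the diagram of cokernels of partial maps. -/
noncomputable def subCokerCocone (hφq : φ ≫ q = 0) :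
    subCokerFunctor Z hZ ⟶ (Functor.const Z).obj F where
  app z := subCokerDesc q hφq (hZ z z.2)
  naturality z w f := by
    change subCokerMap (hZ z z.2) (hZ w w.2) (leOfHom f) ≫ subCokerDesc q hφq (hZ w w.2) =
      subCokerDesc q hφq (hZ z z.2) ≫ 𝟙 F
    rw [← cancel_epi (cokernel.π _), π_subCokerMap_assoc, π_subCokerDesc,
      subCoprodι_subCoprodρ_of_subset_assoc P (leOfHom f).2, π_subCokerDesc_assoc,
      Category.comp_id]

/-- The cokernel of `φ` is the colimit of the cokernels of its restrictions to a directed family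
of pairs of partial coproducts, if every summand occurs in one of them. -/
lemma nonempty_isColimit_subCokerCocone (hφq : φ ≫ q = 0)
    (hq : IsColimit (CokernelCofork.ofπ q hφq)) [IsDirectedOrder Z]
    (hI : ∀ i, ∃ z ∈ Z, i ∈ z.1) (hJ : ∀ j, ∃ z ∈ Z, j ∈ z.2) :
    Nonempty (IsColimit (Cocone.mk F (subCokerCocone q Z hZ hφq))) := by
  have : Epi q := Cofork.IsColimit.epi hq
  choose zI hzI hzI' using hI
  choose zJ hzJ hzJ' using hJ
  let c : ∀ (s : Cocone (subCokerFunctor Z hZ)) (z : Z), cokernel (subMap φ z.1) ⟶ s.pt :=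
    fun s z => s.ι.app z
  have hc : ∀ s (z w : Z) (h : z ≤ w), subCokerMap (hZ z z.2) (hZ w w.2) h ≫ c s w = c s z :=
    fun s z w h => s.w (homOfLE h)
  let t : ∀ (s : Cocone (subCokerFunctor Z hZ)) (z : Z), subCoprod P z.1.2 ⟶ s.pt := fun s z =>
    cokernel.π (subMap φ z.1) ≫ c s z
  have ht : ∀ s (z w : Z) (h : z ≤ w), subCoprodι P z.1.2 ≫ subCoprodρ P w.1.2 ≫ t s w = t s z :=
    fun s z w h => by
      simp only [t, ← hc s z w h, π_subCokerMap_assoc]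
  let d : ∀ s : Cocone (subCokerFunctor Z hZ), ∐ P ⟶ s.pt := fun s =>
    Sigma.desc fun j => Sigma.ι (fun j : (zJ j).2 => P j) ⟨j, hzJ' j⟩ ≫ t s ⟨zJ j, hzJ j⟩
  have hd : ∀ s (z : Z), subCoprodι P z.1.2 ≫ d s = t s z := fun s z => by
    refine Sigma.hom_ext _ _ fun j => ?_
    obtain ⟨v, h1, h2⟩ := exists_ge_ge (⟨zJ j, hzJ j⟩ : Z) z
    rw [ι_subCoprodι_assoc, Sigma.ι_desc, ← ht s _ v h1, ← ht s _ v h2, ι_subCoprodι_assoc,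
      ι_subCoprodι_assoc]
  have hφd : ∀ s, φ ≫ d s = 0 := fun s => by
    refine Sigma.hom_ext _ _ fun i => ?_
    have h1 : Sigma.ι Q i = Sigma.ι (fun i : (zI i).1 => Q i) ⟨i, hzI' i⟩ ≫ subCoprodι Q (zI i).1 :=
      (ι_subCoprodι Q (zI i).1 ⟨i, hzI' i⟩).symm
    have h2 := hd s ⟨zI i, hzI i⟩
    rw [h1, Category.assoc, ← subMap_subCoprodι_assoc (hZ _ (hzI i)), h2]
    simp only [t, cokernel.condition_assoc, zero_comp, comp_zero]
  have hqd : ∀ s, q ≫ hq.desc (CokernelCofork.ofπ (d s) (hφd s)) = d s := fun s =>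
    hq.fac _ WalkingParallelPair.one
  refine ⟨{
    desc s := hq.desc (CokernelCofork.ofπ (d s) (hφd s))
    fac s z := ?_
    uniq s m hm := ?_ }⟩
  · change subCokerDesc q hφq (hZ z z.2) ≫ _ = c s z
    rw [← cancel_epi (cokernel.π _), π_subCokerDesc_assoc, hqd, hd]
  · rw [← cancel_epi q, hqd]
    refine Sigma.hom_ext _ _ fun j => ?_
    have h1 : Sigma.ι P j = Sigma.ι (fun j : (zJ j).2 => P j) ⟨j, hzJ' j⟩ ≫ subCoprodι P (zJ j).2 :=
      (ι_subCoprodι P (zJ j).2 ⟨j, hzJ' j⟩).symm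
    have h2 := hd s ⟨zJ j, hzJ j⟩
    have h3 : subCokerDesc q hφq (hZ _ (hzJ j)) ≫ m = c s ⟨zJ j, hzJ j⟩ := hm ⟨zJ j, hzJ j⟩
    rw [h1, Category.assoc, Category.assoc, h2]
    simp only [t, ← h3, π_subCokerDesc_assoc]

end Cokernels

/-! ### Partial coproducts of vector bundles -/

section

variable {J : Type u} (P : J → X.Modules) (hP : ∀ j, (P j).IsQuasicoherent) {U : X.Opens}
  (hU : IsAffineOpen U)

/-- The sections over `U` of the partial coproduct on `S`, as a submodule of those of `∐ P`; the
two descriptions agree for affine `U` (`range_appₗ_subCoprodι`). -/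
noncomputable def coprodSub (U : X.Opens) (S : Set J) : Submodule Γ(X, U) Γ(∐ P, U) :=
  ⨆ j ∈ S, LinearMap.range (appₗ (Sigma.ι P j) U)

lemma range_le_coprodSub (U : X.Opens) {S : Set J} {j : J} (hj : j ∈ S) :
    LinearMap.range (appₗ (Sigma.ι P j) U) ≤ coprodSub P U S :=
  le_iSup₂_of_le j hj le_rfl

lemma coprodSub_mono (U : X.Opens) {S T : Set J} (h : S ⊆ T) : coprodSub P U S ≤ coprodSub P U T :=
  iSup₂_le fun _ hj => range_le_coprodSub P U (h hj)

lemma coprodSub_iUnion (U : X.Opens) (S : ℕ → Set J) :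
    coprodSub P U (⋃ n, S n) = ⨆ n, coprodSub P U (S n) := by
  refine le_antisymm (iSup₂_le fun j hj => ?_)
    (iSup_le fun n => coprodSub_mono P U (Set.subset_iUnion S n))
  obtain ⟨n, hn⟩ := Set.mem_iUnion.1 hj
  exact (range_le_coprodSub P U hn).trans (le_iSup (fun n => coprodSub P U (S n)) n)

include hP hU in
lemma coprodSub_univ : coprodSub P U Set.univ = ⊤ := by
  rw [eq_top_iff]
  rintro s -
  refine (AddSubgroup.closure_le (coprodSub P U Set.univ).toAddSubgroup).2 ?_
    (coprod_sections P hP hU s)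
  rintro _ ⟨j, p, rfl⟩
  exact range_le_coprodSub P U (Set.mem_univ j) ⟨p, rfl⟩

include hP hU in
lemma range_appₗ_subCoprodι (S : Set J) :
    LinearMap.range (appₗ (subCoprodι P S) U) = coprodSub P U S := by
  have hι : ∀ (j : S) x, appₗ (subCoprodι P S) U (appₗ (Sigma.ι (fun j : S => P j) j) U x) =
      appₗ (Sigma.ι P j) U x := fun j x => congr(appₗ $(ι_subCoprodι P S j) U x)
  apply le_antisymm
  · rw [LinearMap.range_eq_map, ← coprodSub_univ (fun j : S => P j) (fun j => hP j) hU,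
      Submodule.map_le_iff_le_comap]
    refine iSup₂_le fun j _ => ?_
    rintro _ ⟨x, rfl⟩
    rw [Submodule.mem_comap, hι]
    exact range_le_coprodSub P U j.2 ⟨x, rfl⟩
  · refine iSup₂_le fun j hj => ?_
    rintro _ ⟨x, rfl⟩
    exact ⟨_, hι ⟨j, hj⟩ x⟩

lemma range_appₗ_comp {M N K : X.Modules} (f : M ⟶ N) (g : N ⟶ K) (U : X.Opens) :
    LinearMap.range (appₗ (f ≫ g) U) = (LinearMap.range (appₗ f U)).map (appₗ g U) :=
  LinearMap.range_comp (appₗ f U) (appₗ g U)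

lemma appₗ_ρ_ι_of_mem {S : Set J} {x : Γ(∐ P, U)} (hx : x ∈ coprodSub P U S) :
    appₗ (subCoprodρ P S ≫ subCoprodι P S) U x = x := by
  suffices coprodSub P U S ≤
      LinearMap.eqLocus (appₗ (subCoprodρ P S ≫ subCoprodι P S) U) LinearMap.id from this hx
  refine iSup₂_le fun j hj => ?_
  rintro _ ⟨x, rfl⟩
  exact congr(appₗ $(ι_subCoprodρ_subCoprodι P S j hj) U x)

include hP hU in
lemma exists_countable_subset_coprodSub (α : Set Γ(∐ P, U)) (hα : α.Countable) :
    ∃ S : Set J, S.Countable ∧ α ⊆ coprodSub P U S := by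
  have h : ∀ x : Γ(∐ P, U), ∃ S : Set J, S.Countable ∧ x ∈ coprodSub P U S := fun x => by
    have hx : x ∈ ⨆ j, LinearMap.range (appₗ (Sigma.ι P j) U) := by
      have := (coprodSub_univ P hP hU).ge (Submodule.mem_top (x := x))
      simpa [coprodSub] using this
    obtain ⟨s, hs⟩ := Submodule.mem_iSup_iff_exists_finset.1 hx
    exact ⟨s, s.countable_toSet, by simpa [coprodSub] using hs⟩
  choose S hS hxS using h
  refine ⟨⋃ x ∈ α, S x, hα.biUnion fun x _ => hS x, fun x hx => ?_⟩
  exact coprodSub_mono P U (Set.subset_biUnion_of_mem hx) (hxS x)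

end

lemma isLocallyCountablyGenerated_coprod {J : Type u} [Countable J] (P : J → X.Modules)
    (hP : ∀ j, (P j).IsQuasicoherent) (h : ∀ j, IsLocallyCountablyGenerated (P j)) :
    IsLocallyCountablyGenerated (∐ P) := by
  intro U hU
  choose s hs hspan using fun j => h j U hU
  refine ⟨⋃ j, appₗ (Sigma.ι P j) U '' s j, Set.countable_iUnion fun j => (hs j).image _, ?_⟩
  rw [eq_top_iff, ← coprodSub_univ P hP hU]
  refine iSup₂_le fun j _ => ?_
  rw [LinearMap.range_eq_map, ← hspan j, Submodule.map_span]
  exact Submodule.span_mono (Set.subset_iUnion (fun j => appₗ (Sigma.ι P j) U '' s j) j)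

open Classical in
/-- Sections of a coproduct over an affine open are the direct sum of those of the summands, and a
direct sum of projective modules is projective. -/
lemma isVectorBundle_coprod {J : Type u} (P : J → X.Modules) (hP : ∀ j, IsVectorBundle (P j)) :
    IsVectorBundle (∐ P) := by
  refine ⟨isQuasicoherent_coprod P fun j => (hP j).1, fun U hU => ?_⟩
  have := fun j => (hP j).2 U hU
  let f : DirectSum J (fun j => Γ(P j, U)) →ₗ[Γ(X, U)] Γ(∐ P, U) :=
    DirectSum.toModule Γ(X, U) J _ fun j => appₗ (Sigma.ι P j) U
  have hf : ∀ j x, f (DirectSum.lof Γ(X, U) J (fun j => Γ(P j, U)) j x) = appₗ (Sigma.ι P j) U x :=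
    fun j x => DirectSum.toModule_lof _ _ _
  have hsurj : Function.Surjective f := by
    rw [← LinearMap.range_eq_top, eq_top_iff, ← coprodSub_univ P (fun j => (hP j).1) hU]
    refine iSup₂_le fun j _ => ?_
    rintro _ ⟨x, rfl⟩
    exact ⟨_, hf j x⟩
  have hπ : ∀ j, appₗ (Sigma.π P j) U ∘ₗ f = DirectSum.component Γ(X, U) J _ j := fun j => by
    refine DirectSum.linearMap_ext _ fun k => LinearMap.ext fun x => ?_
    simp only [LinearMap.comp_apply, hf]
    by_cases h : k = j
    · subst h
      rw [DirectSum.component.lof_self]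
      exact congr(appₗ $(Sigma.ι_π_eq_id P k) U x)
    · rw [DirectSum.component.of, dif_neg h]
      exact congr(appₗ $(Sigma.ι_π_of_ne P h) U x)
  have hinj : Function.Injective f := by
    rw [injective_iff_map_eq_zero]
    intro x hx
    refine DirectSum.ext_component Γ(X, U) fun j => ?_
    rw [← hπ, LinearMap.comp_apply, hx, map_zero, map_zero]
  have : Module.Projective Γ(X, U) (DirectSum J fun j => Γ(P j, U)) :=
    inferInstanceAs (Module.Projective Γ(X, U) (Π₀ j, Γ(P j, U)))
  exact Module.Projective.of_equiv' (LinearEquiv.ofBijective f ⟨hinj, hsurj⟩)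

lemma hom_ext_of_cover {M N : X.Modules} (hM : M.IsQuasicoherent) (hN : N.IsQuasicoherent)
    (f g : M ⟶ N) {ι : Type*} (U : ι → X.affineOpens) (hcov : (⨆ i, U i : X.Opens) = ⊤)
    (h : ∀ i, appₗ f (U i) = appₗ g (U i)) : f = g := by
  have hl := kernelIsKernel (f - g)
  have hK := isQuasicoherent_kernel hM hN _ _ (kernel.condition (f - g)) hl
  have : Epi (kernel.ι (f - g)) := epi_of_cover hK hM _ U hcov fun i x => by
    refine ((kernel_sections _ _ (kernel.condition (f - g)) hl (U i)).2 x).1 ?_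
    change appₗ f (U i) x - appₗ g (U i) x = 0
    rw [h, sub_self]
  rw [← sub_eq_zero, ← cancel_epi (kernel.ι (f - g)), kernel.condition, comp_zero]

/-- A map from a locally countably generated sheaf to a coproduct factors through a countable
partial coproduct: finitely many affine opens with countably many generators each have to be
considered. -/
lemma exists_countable_support [CompactSpace X] {J : Type u} (P : J → X.Modules)
    (hP : ∀ j, (P j).IsQuasicoherent) {Q : X.Modules} (hQ : Q.IsQuasicoherent)
    (hQ' : IsLocallyCountablyGenerated Q) (f : Q ⟶ ∐ P) :
    ∃ S : Set J, S.Countable ∧ ∀ T, S ⊆ T → f ≫ subCoprodρ P T ≫ subCoprodι P T = f := by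
  obtain ⟨n, U, hcov⟩ := exists_finite_affine_cover X
  have key : ∀ k, ∃ S : Set J, S.Countable ∧ ∀ T, S ⊆ T →
      appₗ (f ≫ subCoprodρ P T ≫ subCoprodι P T) (U k) = appₗ f (U k) := fun k => by
    obtain ⟨s, hs, hspan⟩ := hQ' (U k) (U k).2
    obtain ⟨S, hS, hsS⟩ := exists_countable_subset_coprodSub P hP (U k).2
      (appₗ f (U k) '' s) (hs.image _)
    refine ⟨S, hS, fun T hT => LinearMap.ext_on hspan fun x hx => ?_⟩
    have hx' : appₗ f (U k) x ∈ coprodSub P (U k) T :=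
      coprodSub_mono P _ hT (hsS ⟨x, hx, rfl⟩)
    exact (appₗ_comp f (subCoprodρ P T ≫ subCoprodι P T) (U k).1 x).trans
      (appₗ_ρ_ι_of_mem P (U := (U k).1) hx')
  choose S hS hST using key
  exact ⟨⋃ k, S k, Set.countable_iUnion hS, fun T hT =>
    hom_ext_of_cover hQ (isQuasicoherent_coprod P hP) _ _ U hcov fun k =>
      hST k T ((Set.subset_iUnion S k).trans hT)⟩

/-! ### Flat sheaves as colimits of countable approximations -/

lemma IsCountablyGenerated.of_surjective {R M N : Type*} [CommRing R] [AddCommGroup M] [Module R M]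
    [AddCommGroup N] [Module R N] (h : IsCountablyGenerated R M) (f : M →ₗ[R] N)
    (hf : Function.Surjective f) : IsCountablyGenerated R N := by
  obtain ⟨s, hs, hspan⟩ := h
  exact ⟨f '' s, hs.image f, by
    rw [← Submodule.map_span, hspan, Submodule.map_top, LinearMap.range_eq_top.2 hf]⟩

lemma IsCountablyGenerated.range {R M N : Type*} [CommRing R] [AddCommGroup M] [Module R M]
    [AddCommGroup N] [Module R N] (h : IsCountablyGenerated R M) (f : M →ₗ[R] N) :
    IsCountablyGenerated R (LinearMap.range f) :=
  h.of_surjective f.rangeRestrict f.surjective_rangeRestrict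

lemma injective_appₗ_subCoprodι {J : Type u} (P : J → X.Modules) (S : Set J) (U : X.Opens) :
    Function.Injective (appₗ (subCoprodι P S) U) :=
  Function.LeftInverse.injective (g := appₗ (subCoprodρ P S) U) fun x =>
    congr(appₗ $(subCoprodι_subCoprodρ P S) U x)

section Countable

variable {I J : Type u} {Q : I → X.Modules} {P : J → X.Modules} (φ : ∐ Q ⟶ ∐ P)

/-- A pair of countable index sets to which `φ` restricts. -/
structure IsCountablePair (z : Set I × Set J) : Prop where
  countable_fst : z.1.Countable
  countable_snd : z.2.Countable
  restricts : Restricts φ z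

variable (hQ : ∀ i, IsVectorBundle (Q i) ∧ IsLocallyCountablyGenerated (Q i))
  (hP : ∀ j, IsVectorBundle (P j) ∧ IsLocallyCountablyGenerated (P j))

include hQ in
lemma range_appₗ_ι_comp (S : Set I) {U : X.Opens} (hU : IsAffineOpen U) :
    LinearMap.range (appₗ (subCoprodι Q S ≫ φ) U) = (coprodSub Q U S).map (appₗ φ U) := by
  rw [range_appₗ_comp, range_appₗ_subCoprodι Q (fun i => (hQ i).1.1) hU]

include hP in
lemma isLocallyCountablyGenerated_subCoprod {S : Set J} (hS : S.Countable) :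
    IsLocallyCountablyGenerated (subCoprod P S) := by
  have := hS.to_subtype
  exact isLocallyCountablyGenerated_coprod _ (fun j => (hP j).1.1) fun j => (hP j).2

include hP in
lemma isVectorBundle_subCoprod (S : Set J) : IsVectorBundle (subCoprod P S) :=
  isVectorBundle_coprod _ fun j => (hP j).1

include hQ hP in
lemma isQuasicoherent_cokernel_subMap (z : Set I × Set J) :
    (cokernel (subMap φ z)).IsQuasicoherent :=
  isQuasicoherent_cokernel (isVectorBundle_subCoprod hQ z.1).1 (isVectorBundle_subCoprod hP z.2).1
    _ _ (cokernel.condition _) (cokernelIsCokernel _)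

include hQ hP in
lemma cokernel_subMap_sections (z : Set I × Set J) {U : X.Opens} (hU : IsAffineOpen U) :
    Function.Surjective (appₗ (cokernel.π (subMap φ z)) U) ∧
      Function.Exact (appₗ (subMap φ z) U) (appₗ (cokernel.π (subMap φ z)) U) :=
  cokernel_sections (isVectorBundle_subCoprod hQ z.1).1 (isVectorBundle_subCoprod hP z.2).1
    _ _ (cokernel.condition _) (cokernelIsCokernel _) hU

variable {φ}

include hQ hP in
lemma Restricts.map_coprodSub_le {z : Set I × Set J} (hz : Restricts φ z) {U : X.Opens}
    (hU : IsAffineOpen U) : (coprodSub Q U z.1).map (appₗ φ U) ≤ coprodSub P U z.2 := by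
  rw [← range_appₗ_ι_comp φ hQ z.1 hU, ← subMap_subCoprodι hz,
    ← range_appₗ_subCoprodι P (fun j => (hP j).1.1) hU, range_appₗ_comp]
  exact LinearMap.map_le_range

variable {F : X.Modules} (hF : IsFlatQuasicoherent F) (q : ∐ P ⟶ F) (hφq : φ ≫ q = 0)
  (hq : IsColimit (CokernelCofork.ofπ q hφq))

include hQ hP hF hq in
/-- Over a fixed affine open, any countable pair can be enlarged so that the relations valid in
the smaller cokernel factor through finite free modules in the larger one. -/
lemma exists_countable_factorsThroughFree_sections {z : Set I × Set J} (hz : IsCountablePair φ z)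
    {U : X.Opens} (hU : IsAffineOpen U) :
    ∃ (S : Set I) (T : Set J), S.Countable ∧ T.Countable ∧ ∀ w : Set I × Set J, S ⊆ w.1 → T ⊆ w.2 →
      FactorsThroughFree (coprodSub P U z.2) ((coprodSub Q U z.1).map (appₗ φ U))
        (coprodSub P U w.2) ((coprodSub Q U w.1).map (appₗ φ U)) := by
  have hP' := fun j => (hP j).1.1
  have hQ' := fun i => (hQ i).1.1
  have hsec := cokernel_sections (isQuasicoherent_coprod Q hQ') (isQuasicoherent_coprod P hP')
    φ q hφq hq hU
  have hflat : Module.Flat Γ(X, U) (Γ(∐ P, U) ⧸ LinearMap.range (appₗ φ U)) := by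
    have := hF.2 U hU
    rw [← hsec.2.linearMap_ker_eq]
    exact Module.Flat.of_linearEquiv ((appₗ q U).quotKerEquivOfSurjective hsec.1)
  have hproj : Module.Projective Γ(X, U) (coprodSub P U z.2) := by
    have := (isVectorBundle_subCoprod hP z.2).2 U hU
    rw [← range_appₗ_subCoprodι P hP' hU]
    exact Module.Projective.of_equiv'
      (LinearEquiv.ofInjective _ (injective_appₗ_subCoprodι P z.2 U))
  have hA : IsCountablyGenerated Γ(X, U) (coprodSub P U z.2) := by
    rw [← range_appₗ_subCoprodι P hP' hU]
    exact (isLocallyCountablyGenerated_subCoprod hP hz.2 U hU).range _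
  have hB : IsCountablyGenerated Γ(X, U) ((coprodSub Q U z.1).map (appₗ φ U)) := by
    rw [← range_appₗ_ι_comp φ hQ z.1 hU]
    exact (isLocallyCountablyGenerated_subCoprod hQ hz.1 U hU).range _
  obtain ⟨α, β, hα, hβ, hβC, h⟩ := exists_countable_factorsThroughFree _ _
    (LinearMap.range (appₗ φ U)) hA hB (hz.3.map_coprodSub_le hQ hP hU) LinearMap.map_le_range
  obtain ⟨T, hT, hαT⟩ := exists_countable_subset_coprodSub P hP' hU α hα
  have hβC' : ∀ b ∈ β, ∃ y, appₗ φ U y = b := fun b hb => hβC hb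
  choose! y hy using hβC'
  obtain ⟨S, hS, hβS⟩ := exists_countable_subset_coprodSub Q hQ' hU (y '' β) (hβ.image y)
  refine ⟨S, T, hS, hT, fun w hSw hTw => h _ _ (hαT.trans (coprodSub_mono P U hTw)) fun b hb => ?_⟩
  exact ⟨y b, coprodSub_mono Q U hSw (hβS ⟨b, hb, rfl⟩), hy b hb⟩

lemma Restricts.iUnion (z : ℕ → Set I × Set J) (h : ∀ n, Restricts φ (z n)) :
    Restricts φ (⋃ n, (z n).1, ⋃ n, (z n).2) := by
  intro i hi
  obtain ⟨n, hn⟩ := Set.mem_iUnion.1 hi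
  have h1 := h n i hn
  have h2 := h1 =≫ (subCoprodρ P (⋃ n, (z n).2) ≫ subCoprodι P (⋃ n, (z n).2))
  simp only [Category.assoc] at h2
  rw [subCoprodι_subCoprodρ_of_subset P (Set.subset_iUnion (fun n => (z n).2) n)] at h2
  exact h2.symm.trans h1

include hQ hP in
/-- A flat cokernel of a map of countable coproducts is locally a countably presented flat module,
so the kernel of its presentation is a vector bundle. -/
lemma vDimLEOne_cokernel_subMap {z : Set I × Set J} (hz : IsCountablePair φ z)
    (hflat : IsFlatQuasicoherent (cokernel (subMap φ z))) : VDimLEOne (cokernel (subMap φ z)) := by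
  have hP₀ := isVectorBundle_subCoprod hP z.2
  set g := cokernel.π (subMap φ z)
  have hl := kernelIsKernel g
  refine ⟨kernel g, subCoprod P z.2, kernel.ι g, g, kernel.condition g,
    ⟨isQuasicoherent_kernel hP₀.1 hflat.1 _ g (kernel.condition g) hl, fun U hU => ?_⟩, hP₀,
    ⟨ShortComplex.exact_of_f_is_kernel _ hl⟩⟩
  have hsec := cokernel_subMap_sections φ hQ hP z hU
  have hker := kernel_sections _ g (kernel.condition g) hl U
  have := hflat.2 U hU
  have := hP₀.2 U hU
  have hB : IsCountablyGenerated Γ(X, U) (LinearMap.ker (appₗ g U)) := by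
    rw [hsec.2.linearMap_ker_eq]
    exact (isLocallyCountablyGenerated_subCoprod hQ hz.1 U hU).range _
  have := projective_ker_of_flat_of_countable
    (isLocallyCountablyGenerated_subCoprod hP hz.2 U hU) (appₗ g U) hsec.1 hB (appₗ g U) hsec.1
  rw [hker.2.linearMap_ker_eq] at this
  exact Module.Projective.of_equiv' (LinearEquiv.ofInjective _ hker.1).symm

variable [CompactSpace X]

include hQ hP in
/-- Each of countably many summands `Q i` is mapped into a countable partial coproduct, so adding
countably many indices suffices for `φ` to restrict. -/
lemma exists_isCountablePair (S : Set I) (T : Set J) (hS : S.Countable) (hT : T.Countable) :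
    ∃ z : Set I × Set J, IsCountablePair φ z ∧ S ⊆ z.1 ∧ T ⊆ z.2 := by
  choose supp hsupp h using fun i => exists_countable_support P (fun j => (hP j).1.1)
    (hQ i).1.1 (hQ i).2 (Sigma.ι Q i ≫ φ)
  refine ⟨(S, T ∪ ⋃ i ∈ S, supp i), ⟨hS, hT.union (hS.biUnion fun i _ => hsupp i),
    fun i hi => ?_⟩, subset_rfl, Set.subset_union_left⟩
  have := h i (T ∪ ⋃ i ∈ S, supp i)
    ((Set.subset_biUnion_of_mem hi).trans Set.subset_union_right)
  simpa only [Category.assoc] using this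

include hQ hP hF hq in
/-- The pairs for which the cokernel is flat are cofinal. Starting from any pair, a chain of pairs
is built in which each step trivializes the relations of the previous one over all members of a
finite affine cover; the union of the chain has flat cokernel. -/
lemma exists_flat_isCountablePair (S : Set I) (T : Set J) (hS : S.Countable) (hT : T.Countable) :
    ∃ z : Set I × Set J, IsCountablePair φ z ∧ S ⊆ z.1 ∧ T ⊆ z.2 ∧
      IsFlatQuasicoherent (cokernel (subMap φ z)) := by
  obtain ⟨n, U, hcov⟩ := exists_finite_affine_cover X
  have hP' := fun j => (hP j).1.1
  have hQ' := fun i => (hQ i).1.1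
  let W := {z : Set I × Set J // IsCountablePair φ z}
  -- One enlargement serves all members of the finite cover.
  have step : ∀ z : W, ∃ w : W, z ≤ w ∧ ∀ k,
      FactorsThroughFree (coprodSub P (U k) z.1.2) ((coprodSub Q (U k) z.1.1).map (appₗ φ (U k)))
        (coprodSub P (U k) w.1.2) ((coprodSub Q (U k) w.1.1).map (appₗ φ (U k))) := by
    rintro ⟨z, hz⟩
    choose S T hS hT h using fun k =>
      exists_countable_factorsThroughFree_sections hQ hP hF q hφq hq hz (U k).2
    obtain ⟨w, hw, hSw, hTw⟩ := exists_isCountablePair hQ hP (φ := φ) (z.1 ∪ ⋃ k, S k)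
      (z.2 ∪ ⋃ k, T k) (hz.1.union (Set.countable_iUnion hS)) (hz.2.union (Set.countable_iUnion hT))
    exact ⟨⟨w, hw⟩, ⟨Set.subset_union_left.trans hSw, Set.subset_union_left.trans hTw⟩,
      fun k => h k w
        ((Set.subset_iUnion S k).trans (Set.subset_union_right.trans hSw))
        ((Set.subset_iUnion T k).trans (Set.subset_union_right.trans hTw))⟩
  choose next hle hnext using step
  obtain ⟨z₀, hz₀, hS₀, hT₀⟩ := exists_isCountablePair hQ hP (φ := φ) S T hS hT
  let z : ℕ → W := fun n => next^[n] ⟨z₀, hz₀⟩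
  have hzs : ∀ n, z (n + 1) = next (z n) := fun n => Function.iterate_succ_apply' next n _
  have hzmono : Monotone fun n => (z n).1 := monotone_nat_of_le_succ fun n => by
    rw [hzs]; exact hle (z n)
  let v : Set I × Set J := (⋃ n, (z n).1.1, ⋃ n, (z n).1.2)
  have hv : IsCountablePair φ v := ⟨Set.countable_iUnion fun n => (z n).2.1,
    Set.countable_iUnion fun n => (z n).2.2,
    Restricts.iUnion (fun n => (z n).1) fun n => (z n).2.3⟩
  have hzv : ∀ n, (z n).1 ≤ v := fun n =>
    ⟨Set.subset_iUnion (fun n => (z n).1.1) n, Set.subset_iUnion (fun n => (z n).1.2) n⟩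
  have hcoh := isQuasicoherent_cokernel_subMap φ hQ hP v
  refine ⟨v, hv, hS₀.trans (hzv 0).1, hT₀.trans (hzv 0).2, hcoh, fun V hV =>
    flat_of_cover _ hcoh U hcov (fun k => ?_) ⟨V, hV⟩⟩
  have hsec := cokernel_subMap_sections φ hQ hP v (U k).2
  refine flat_of_chain (fun n => coprodSub P (U k) (z n).1.2)
    (fun n => (coprodSub Q (U k) (z n).1.1).map (appₗ φ (U k)))
    (fun m n h => coprodSub_mono P _ (hzmono h).2)
    (fun m n h => Submodule.map_mono (coprodSub_mono Q _ (hzmono h).1))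
    (fun n => ?_) (appₗ (subCoprodι P v.2) (U k)) ?_
    (appₗ (cokernel.π (subMap φ v)) (U k)) hsec.1 fun a => ?_
  · rw [hzs]
    exact hnext (z n) k
  · rw [range_appₗ_subCoprodι P hP' (U k).2, coprodSub_iUnion]
  · rw [hsec.2 a, ← Submodule.map_iSup, ← coprodSub_iUnion]
    change _ ↔ _ ∈ (coprodSub Q (U k) v.1).map (appₗ φ (U k))
    rw [← range_appₗ_ι_comp φ hQ v.1 (U k).2, ← subMap_subCoprodι hv.3, range_appₗ_comp]
    exact ((injective_appₗ_subCoprodι P v.2 (U k)).mem_set_image).symm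

end Countable

/-- Every countable pair `(S, T)` lies in a countable pair `z` adapted to a presentation
`∐ Q ⟶ ∐ P ⟶ F ⟶ 0` for which `∐_{z.1} Q ⟶ ∐_{z.2} P` has flat cokernel. Such pairs are therefore
directed, and the flat sheaf `F` is the colimit of the corresponding cokernels. -/
theorem exists_directed_colimit_of_isFlatQuasicoherent [CompactSpace X]
    (hX : HasEnoughLocallyCountablyGeneratedVectorBundles X) {F : X.Modules}
    (hF : IsFlatQuasicoherent F) :
    ∃ (I : Type u) (_ : PartialOrder I) (_ : IsDirectedOrder I) (_ : Nonempty I)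
      (D : I ⥤ X.Modules) (ι : D ⟶ (Functor.const I).obj F),
      Nonempty (IsColimit (Cocone.mk F ι)) ∧
      ∀ i : I, IsFlatQuasicoherent (D.obj i) ∧ IsLocallyCountablyGenerated (D.obj i) ∧
        VDimLEOne (D.obj i) := by
  obtain ⟨J, P, q, hP, _⟩ := hX F hF.1
  have hK := isQuasicoherent_kernel (isQuasicoherent_coprod P fun j => (hP j).1.1) hF.1 _ q
    (kernel.condition q) (kernelIsKernel q)
  obtain ⟨I, Q, p, hQ, _⟩ := hX (kernel q) hK
  let φ : ∐ Q ⟶ ∐ P := p ≫ kernel.ι q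
  have hφq : φ ≫ q = 0 := by simp [φ]
  have hq : IsColimit (CokernelCofork.ofπ q hφq) := 
    isCokernelEpiComp (Abelian.epiIsCokernelOfKernel _ (kernelIsKernel q)) p rfl
  let Z : Set (Set I × Set J) :=
    {z | IsCountablePair φ z ∧ IsFlatQuasicoherent (cokernel (subMap φ z))}
  have hZ : ∀ z ∈ Z, Restricts φ z := fun z hz => hz.1.3
  have hex : ∀ (S : Set I) (T : Set J), S.Countable → T.Countable →
      ∃ z ∈ Z, S ⊆ z.1 ∧ T ⊆ z.2 := fun S T hS hT => by
    obtain ⟨z, hz, hS, hT, hflat⟩ := exists_flat_isCountablePair hQ hP hF q hφq hq S T hS hT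
    exact ⟨z, ⟨hz, hflat⟩, hS, hT⟩
  have hdir : IsDirectedOrder Z := ⟨fun z w => by
    obtain ⟨v, hv, h1, h2⟩ := hex (z.1.1 ∪ w.1.1) (z.1.2 ∪ w.1.2)
      (z.2.1.1.union w.2.1.1) (z.2.1.2.union w.2.1.2)
    exact ⟨⟨v, hv⟩, ⟨Set.subset_union_left.trans h1, Set.subset_union_left.trans h2⟩,
      ⟨Set.subset_union_right.trans h1, Set.subset_union_right.trans h2⟩⟩⟩
  have hne : Nonempty Z := by
    obtain ⟨z, hz, -⟩ := hex ∅ ∅ Set.countable_empty Set.countable_empty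
    exact ⟨⟨z, hz⟩⟩
  refine ⟨Z, inferInstance, hdir, hne, subCokerFunctor Z hZ, subCokerCocone q Z hZ hφq,
    nonempty_isColimit_subCokerCocone q Z hZ hφq hq (fun i => ?_) (fun j => ?_), fun z => ?_⟩
  · obtain ⟨z, hz, h, -⟩ := hex {i} ∅ (Set.countable_singleton i) Set.countable_empty
    exact ⟨z, hz, h rfl⟩
  · obtain ⟨z, hz, -, h⟩ := hex ∅ {j} Set.countable_empty (Set.countable_singleton j)
    exact ⟨z, hz, h rfl⟩
  · refine ⟨z.2.2, fun U hU => ?_, vDimLEOne_cokernel_subMap hQ hP z.2.1 z.2.2⟩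
    exact (isLocallyCountablyGenerated_subCoprod hP z.2.1.2 U hU).of_surjective _
      (cokernel_subMap_sections φ hQ hP z.1 hU).1

end QCohSheaf

theorem theorem4 (X : Scheme.{u}) [CompactSpace X]
    [IsAffineHom (pullback.diagonal (terminal.from X))] :
    (QCohSheaf.HasResolutionProperty X →
      QCohSheaf.HasEnoughLocallyCountablyGeneratedVectorBundles X) ∧
    (QCohSheaf.HasEnoughLocallyCountablyGeneratedVectorBundles X →
      ∀ F : X.Modules, QCohSheaf.IsFlatQuasicoherent F →
        ∃ (I : Type u) (_ : PartialOrder I) (_ : IsDirectedOrder I) (_ : Nonempty I)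
          (D : I ⥤ X.Modules) (ι : D ⟶ (Functor.const I).obj F),
          Nonempty (IsColimit (Cocone.mk F ι)) ∧
          ∀ i : I, QCohSheaf.IsFlatQuasicoherent (D.obj i) ∧
            QCohSheaf.IsLocallyCountablyGenerated (D.obj i) ∧
            QCohSheaf.VDimLEOne (D.obj i)) := by
  exact ⟨QCohSheaf.hasEnough_of_hasResolutionProperty, fun hX F hF =>
    QCohSheaf.exists_directed_colimit_of_isFlatQuasicoherent hX hF⟩
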